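/- **Theorem 2.3 (multisymplectic form formula).** Let $\sigma\in\mathbb R$, let $X\subseteq\mathbb R^3$ be open with coordinates $(x,y,t)$, and let $Y=X\times\mathbb R\to X$ be the trivial line bundle, whose smooth sections are the smooth functions $\varphi:X\to\mathbb R$. Let $J^5(Y)$ be the fifth jet bundle, with coordinates $x,y,t$ and $\varphi_J$ ($J$ a multi-index in $x,y,t$ with $|J|\le 5$), and let $j^5(\varphi)$ be the fifth jet prolongation of a section $\varphi$. For the Lagrangian density $$L=\bigl(\varphi_{xx}\varphi_{xt}-\tfrac12\varphi_{xxx}^2+\tfrac{\sigma}{2}\varphi_{xy}^2+\varphi_{xx}^3\bigr)\,dx\wedge dy\wedge dt$$ of the KP equation in potential form, $2\varphi_{xxxt}+6\varphi_{xx}\varphi_{xxxx}+6\varphi_{xxx}^2+\varphi_{xxxxxx}+\sigma\varphi_{xxyy}=0$ (where $u=\varphi_{xx}$), let $\theta_L$ be the Cartan form on $J^5(Y)$ $$\begin{aligned}\theta_L={}&\bigl(\tfrac12\varphi_{xxx}^2-\tfrac{\sigma}{2}\varphi_{xy}^2+2\varphi_x\varphi_{xxt}+6\varphi_x\varphi_{xx}\varphi_{xxx}+\sigma\varphi_x\varphi_{xyy}+\varphi_x\varphi_{xxxxx}-\varphi_{xx}\varphi_{xt}-2\varphi_{xx}^3-\varphi_{xx}\varphi_{xxxx}\bigr)\,dx\wedge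 dy\wedge dt\\&+(-2\varphi_{xxt}-6\varphi_{xx}\varphi_{xxx}-\sigma\varphi_{xyy}-\varphi_{xxxxx})\,d\varphi\wedge dy\wedge dt+(\varphi_{xt}+3\varphi_{xx}^2+\varphi_{xxxx})\,d\varphi_x\wedge dy\wedge dt\\&-\varphi_{xxx}\,d\varphi_{xx}\wedge dy\wedge dt-\sigma\varphi_{xy}\,d\varphi_x\wedge dx\wedge dt+\varphi_{xx}\,d\varphi_x\wedge dx\wedge dy,\end{aligned}$$ and let $\Omega_L=-d\theta_L$. A *solution* is a smooth section $\varphi$ over $X$ that satisfies the Euler–Lagrange equation $j^5(\varphi)^*(P\lrcorner\Omega_L)=0$ for every smooth vector field $P$ on $J^5(Y)$. Let $\eta_Y^\lambda$ and $\xi_Y^\lambda$ ($\lambda\in\mathbb R$) be two smooth one-parameter groups of automorphisms of the bundle $Y\to X$, covering $\eta_X^\lambda$ and $\xi_X^\lambda$, which are symmetry groups of the Euler–Lagrange equation: for every solution $\varphi$ and every $\lambda$, the sections $\eta_Y^\lambda\circ\varphi\circ(\eta_X^\lambda)^{-1}$ and $\xi_Y^\lambda\circ\varphi\circ(\xi_X^\lambda)^{-1}$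 are again solutions. Let $V$ and $W$ be their generating vector fields on $Y$, and let $j^5(V)$ and $j^5(W)$ be the prolongations of these to $J^5(Y)$, i.e. the generators of the prolonged groups $j^5(\eta_Y^\lambda)$ and $j^5(\xi_Y^\lambda)$, where $j^5(\eta_Y^\lambda)$ maps $j^5(\psi)(p)$ to $j^5\bigl(\eta_Y^\lambda\circ\psi\circ(\eta_X^\lambda)^{-1}\bigr)(\eta_X^\lambda(p))$. Then for every solution $\varphi$ and every bounded open set $U$ with $\overline U\subseteq X$ whose closure is a $C^2$ domain with corners (that is, near each point of $\overline U$, after an orientation-preserving $C^2$ change of coordinates, $U$ is given by $z_j<0$ for all $j$ in some subset of the three coordinate indices), $$\int_{\partial U} j^5(\varphi)^*\bigl(j^5(V)\lrcorner j^5(W)\lrcorner\Omega_L\bigr)=0,$$ where $\partial U$ has the boundary orientation. -/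

import Mathlib

open Set MeasureTheory
open scoped ContDiff

noncomputable section

namespace KP

/-- Space-time `ℝ³` with coordinates `(x, y, t) = (p 0, p 1, p 2)`. -/
abbrev Base : Type := Fin 3 → ℝ

/-- Multi-indices `(a, b, c)` with `a + b + c ≤ 5`; they label the jet coordinate
`∂ₓᵃ ∂ᵧᵇ ∂ₜᶜ φ`. -/
abbrev Idx : Type := {J : Fin 3 → Fin 6 // ∑ i, (J i : ℕ) ≤ 5}

/-- The multi-index `(a, b, c)`. -/
def mi (a b c : Fin 6) (h : (a : ℕ) + b + c ≤ 5 := by decide) : Idx :=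
  ⟨![a, b, c], by simpa [Fin.sum_univ_three] using h⟩

/-- The fifth jet bundle of the trivial line bundle `ℝ³ × ℝ → ℝ³`, in its global coordinates:
a base point and the `56` values `φ_J`, `|J| ≤ 5`. For an open `X ⊆ ℝ³`, the jets over `X` are
the `z` with `z.1 ∈ X`. -/
abbrev J5 : Type := Base × (Idx → ℝ)

/-! ### Jets of sections -/

/-- Partial derivative in the `i`-th coordinate. -/
def pd (i : Fin 3) (f : Base → ℝ) (p : Base) : ℝ := fderiv ℝ f p (Pi.single i 1)

/-- The partial derivative `∂^J f`. -/
def pdJ (J : Idx) (f : Base → ℝ) : Base → ℝ :=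
  (pd 0)^[(J.1 0 : ℕ)] ((pd 1)^[(J.1 1 : ℕ)] ((pd 2)^[(J.1 2 : ℕ)] f))

/-- The fifth jet prolongation `j⁵(φ)`. -/
def jet (φ : Base → ℝ) (p : Base) : J5 := (p, fun J => pdJ J φ p)

/-- The polynomial section whose fifth jet at the point `z.1` is `z`. -/
def taylor (z : J5) (q : Base) : ℝ :=
  ∑ J : Idx, z.2 J * ∏ i, (q i - z.1 i) ^ (J.1 i : ℕ) / (Nat.factorial (J.1 i : ℕ) : ℝ)

/-! ### Differential forms -/

/-- Interior product `V ⌟ β`. -/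
def contract {E : Type*} [NormedAddCommGroup E] [NormedSpace ℝ E] {n : ℕ}
    (V : E → E) (β : E → E [⋀^Fin (n + 1)]→L[ℝ] ℝ) : E → E [⋀^Fin n]→L[ℝ] ℝ :=
  fun z => (β z).curryLeft (V z)

/-- Pull-back `f^* β`. -/
def pullback {E F : Type*} [NormedAddCommGroup E] [NormedSpace ℝ E]
    [NormedAddCommGroup F] [NormedSpace ℝ F] {n : ℕ}
    (f : E → F) (β : F → F [⋀^Fin n]→L[ℝ] ℝ) : E → E [⋀^Fin n]→L[ℝ] ℝ :=
  fun p => (β (f p)).compContinuousLinearMap (fderiv ℝ f p)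

/-- The wedge product `a ∧ b ∧ c` of three covectors, so that
`(a ∧ b ∧ c) (v₀, v₁, v₂) = det (![a, b, c] i (v j))`. -/
def wedge3 (a b c : J5 →L[ℝ] ℝ) : J5 [⋀^Fin 3]→L[ℝ] ℝ :=
  ContinuousMultilinearMap.alternatization
    ((ContinuousMultilinearMap.mkPiAlgebra ℝ (Fin 3) ℝ).compContinuousLinearMap ![a, b, c])

/-- The covectors `dx, dy, dt` on the jet bundle. -/
def dX (i : Fin 3) : J5 →L[ℝ] ℝ :=
  (ContinuousLinearMap.proj i).comp (ContinuousLinearMap.fst ℝ Base (Idx → ℝ))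

/-- The covector `dφ_J` on the jet bundle. -/
def dPhi (J : Idx) : J5 →L[ℝ] ℝ :=
  (ContinuousLinearMap.proj J).comp (ContinuousLinearMap.snd ℝ Base (Idx → ℝ))

/-- The Cartan form `θ_L` of the Lagrangian density
`(φ_xx φ_xt - φ_xxx² / 2 + (σ / 2) φ_xy² + φ_xx³) dx ∧ dy ∧ dt`. -/
def theta (σ : ℝ) (z : J5) : J5 [⋀^Fin 3]→L[ℝ] ℝ :=
  let φx := z.2 (mi 1 0 0)
  let φxx := z.2 (mi 2 0 0)
  let φxy := z.2 (mi 1 1 0)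
  let φxt := z.2 (mi 1 0 1)
  let φxxx := z.2 (mi 3 0 0)
  let φxxt := z.2 (mi 2 0 1)
  let φxyy := z.2 (mi 1 2 0)
  let φxxxx := z.2 (mi 4 0 0)
  let φxxxxx := z.2 (mi 5 0 0)
  let dx := dX 0
  let dy := dX 1
  let dt := dX 2
  let dφ := dPhi (mi 0 0 0)
  let dφx := dPhi (mi 1 0 0)
  let dφxx := dPhi (mi 2 0 0)
  (1 / 2 * φxxx ^ 2 - σ / 2 * φxy ^ 2 + 2 * φx * φxxt + 6 * φx * φxx * φxxx
      + σ * φx * φxyy + φx * φxxxxx - φxx * φxt - 2 * φxx ^ 3 - φxx * φxxxx) • wedge3 dx dy dt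
    + (-2 * φxxt - 6 * φxx * φxxx - σ * φxyy - φxxxxx) • wedge3 dφ dy dt
    + (φxt + 3 * φxx ^ 2 + φxxxx) • wedge3 dφx dy dt
    - φxxx • wedge3 dφxx dy dt
    - (σ * φxy) • wedge3 dφx dx dt
    + φxx • wedge3 dφx dx dy

/-- The multisymplectic form `Ω_L = -dθ_L`. -/
def Omega (σ : ℝ) (z : J5) : J5 [⋀^Fin 4]→L[ℝ] ℝ := -extDeriv (theta σ) z

/-- `φ` is a smooth section over the open set `X` which solves the Euler–Lagrange equation
`j⁵(φ)^* (W ⌟ Ω_L) = 0` for all smooth vector fields `W` on the fifth jet bundle over `X`. -/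
def IsSolution (σ : ℝ) (X : Set Base) (φ : Base → ℝ) : Prop :=
  ContDiffOn ℝ ∞ φ X ∧
    ∀ W : J5 → J5, ContDiffOn ℝ ∞ W {z | z.1 ∈ X} →
      ∀ p ∈ X, pullback (jet φ) (contract W (Omega σ)) p = 0

/-! ### One-parameter groups of bundle automorphisms -/

/-- A smooth one-parameter group `η_Y^s (p, u) = (base s p, fib s p u)`, `s ∈ ℝ`, of automorphisms
of the bundle `X × ℝ → X`, covering `η_X^s = base s`. -/
structure OneParamGroup (X : Set Base) where
  base : ℝ → Base → Base
  fib : ℝ → Base → ℝ → ℝ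
  mapsTo : ∀ s, MapsTo (base s) X X
  contDiffOn_base : ContDiffOn ℝ ∞ (fun q : ℝ × Base => base q.1 q.2) (univ ×ˢ X)
  contDiffOn_fib :
    ContDiffOn ℝ ∞ (fun q : ℝ × Base × ℝ => fib q.1 q.2.1 q.2.2) (univ ×ˢ X ×ˢ univ)
  base_zero : ∀ p ∈ X, base 0 p = p
  fib_zero : ∀ p ∈ X, ∀ u, fib 0 p u = u
  base_add : ∀ r s, ∀ p ∈ X, base (r + s) p = base r (base s p)
  fib_add : ∀ r s, ∀ p ∈ X, ∀ u, fib (r + s) p u = fib r (base s p) (fib s p u)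

namespace OneParamGroup

variable {X : Set Base}

/-- The transformed section `η_Y^s ∘ φ ∘ (η_X^s)⁻¹`; note `(η_X^s)⁻¹ = η_X^(-s)`. -/
def act (η : OneParamGroup X) (s : ℝ) (φ : Base → ℝ) (p : Base) : ℝ :=
  η.fib s (η.base (-s) p) (φ (η.base (-s) p))

/-- The prolongation `j⁵(η_Y^s)` to the jet bundle: a jet `z = j⁵(ψ)(p)` is sent to the jet at
`η_X^s p` of the transformed section `η_Y^s ∘ ψ ∘ (η_X^s)⁻¹`, where `ψ` is the polynomial
representative of `z`. -/
def prolong (η : OneParamGroup X) (s : ℝ) (z : J5) : J5 :=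
  jet (η.act s (taylor z)) (η.base s z.1)

/-- The prolonged vector field `j⁵(V)`, where `V` generates `η_Y^s`: the infinitesimal generator
of the prolonged group `j⁵(η_Y^s)`. -/
def jetGenerator (η : OneParamGroup X) (z : J5) : J5 := deriv (fun s => η.prolong s z) 0

/-- `η` is a symmetry group of the Euler–Lagrange equation: it maps solutions to solutions. -/
def IsSymmetry (σ : ℝ) (η : OneParamGroup X) : Prop :=
  ∀ φ : Base → ℝ, IsSolution σ X φ → ∀ s, IsSolution σ X (η.act s φ)

end OneParamGroup

/-! ### Integration over the boundary of a domain -/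

/-- A finite oriented `C²` atlas of `closure U`, as a domain with corners in `ℝ³`, together with a
partition of unity subordinate to it. In the chart `i` the set `U` is
`{z | z j < 0 for all j ∈ S i}`: thus `S i = ∅` for an interior chart, `S i` has one element at a
smooth boundary point, two at an edge and three at a vertex. -/
structure CornerAtlas (U : Set Base) where
  n : ℕ
  chart : Fin n → OpenPartialHomeomorph Base Base
  S : Fin n → Finset (Fin 3)
  rho : Fin n → Base → ℝ
  contDiffOn_chart : ∀ i, ContDiffOn ℝ 2 (chart i) (chart i).source
  det_pos : ∀ i, ∀ z ∈ (chart i).source, 0 < (fderiv ℝ (chart i) z).det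
  mem_iff : ∀ i, ∀ z ∈ (chart i).source, chart i z ∈ U ↔ ∀ j ∈ S i, z j < 0
  contDiff_rho : ∀ i, ContDiff ℝ 1 (rho i)
  hasCompactSupport_rho : ∀ i, HasCompactSupport (rho i)
  tsupport_rho : ∀ i, tsupport (rho i) ⊆ (chart i).target
  sum_rho : ∀ p ∈ closure U, ∑ i, rho i p = 1

/-- The integral `∫_{∂U} α` of a 2-form for the boundary orientation: in the chart `i`, the boundary
is the union over `j ∈ S i` of the faces `{z j = 0}`, on which the outward-normal-first
orientation is `(-1)^j` times that of the remaining two coordinates. -/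
def CornerAtlas.boundaryIntegral {U : Set Base} (A : CornerAtlas U)
    (α : Base → Base [⋀^Fin 2]→L[ℝ] ℝ) : ℝ :=
  ∑ i, ∑ j ∈ A.S i, (-1 : ℝ) ^ (j : ℕ) *
    ∫ w in {w : Fin 2 → ℝ | j.insertNth 0 w ∈ (A.chart i).source ∧
        ∀ k ∈ A.S i, k ≠ j → (j.insertNth 0 w : Base) k < 0},
      A.rho i (A.chart i (j.insertNth 0 w)) *
        pullback (A.chart i) α (j.insertNth 0 w) (fun k => Pi.single (j.succAbove k) 1)

end KP

end

noncomputable section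

namespace KP

section Stokes

/-! ### Stokes' theorem on a domain with corners -/

/-! The integrand is a closed 2-form on `X`, so its boundary integral vanishes by Stokes' theorem.

Closedness is an infinitesimal statement about the solution `φ`. Along its jet, the prolonged
generator of a symmetry splits into a vector tangent to the image of the jet and the vertical jet of
the variation `d/ds (η_Y^s ∘ φ ∘ (η_X^s)⁻¹)` at `s = 0` (`OneParamGroup.jetGenerator_jet`). The
Euler–Lagrange equation says that `Omega` vanishes as soon as three of its arguments are tangent to
the jet. Hence only the vertical parts contribute, and the pulled-back form is a current bilinear
and antisymmetric in the two variations (`pullback_contract_apply`).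

Testing the Euler–Lagrange equation with `∂/∂φ` gives the KP equation (`IsSolution.kp`). Since a
symmetry maps solutions to solutions, differentiating KP in the group parameter shows that each
variation solves the linearized equation (`OneParamGroup.IsSymmetry.isLinearizedSolution`). The
linearized operator `ℓ` is formally self-adjoint: the divergence of the current of `W` and `V` is `W
ℓ(V) - V ℓ(W)`, which is zero here (`div_flux_eq_zero`).

Two further ingredients are needed. The prolongation is defined through a polynomial representative
of a jet, and `OneParamGroup.prolong_jet` shows, by the chain rule for iterated derivatives, that
any smooth section with the same 5-jet gives the same result. Stokes' theorem with corners
(`CornerAtlas.boundaryIntegral_eq`) is reduced by the partition of unity and the charts to the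
fundamental theorem of calculus on quadrants. -/

theorem hasDerivAt_insertNth {n : ℕ} (j : Fin (n + 1)) (w : Fin n → ℝ) (r : ℝ) :
    HasDerivAt (fun r : ℝ => (j.insertNth r w : Fin (n + 1) → ℝ)) (Pi.single j 1) r := by
  rw [hasDerivAt_pi]
  refine j.forall_iff_succAbove.2 ⟨?_, fun k => ?_⟩
  · simpa using hasDerivAt_id' r
  · simpa using hasDerivAt_const r (w k)

theorem contDiff_insertNth {n : ℕ} (j : Fin (n + 1)) (w : Fin n → ℝ) :
    ContDiff ℝ ∞ (fun r : ℝ => (j.insertNth r w : Fin (n + 1) → ℝ)) := by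
  rw [contDiff_pi]
  refine j.forall_iff_succAbove.2 ⟨?_, fun k => ?_⟩
  · simpa using contDiff_fun_id
  · simpa using contDiff_const

theorem hasCompactSupport_comp_insertNth {n : ℕ} {f : (Fin (n + 1) → ℝ) → ℝ}
    (hf : HasCompactSupport f) (j : Fin (n + 1)) (w : Fin n → ℝ) :
    HasCompactSupport (fun r : ℝ => f (j.insertNth r w)) := by
  refine HasCompactSupport.intro (K := (fun z : Fin (n + 1) → ℝ => z j) '' tsupport f)
    (hf.isCompact.image (continuous_apply j)) fun r hr => ?_
  by_contra h
  exact hr ⟨_, subset_tsupport f h, by simp⟩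

/-- The quadrant `{z | z k < 0 for all k ∈ S}`. -/
def quadrant {n : ℕ} (S : Finset (Fin n)) : Set (Fin n → ℝ) := {z | ∀ k ∈ S, z k < 0}

theorem measurableSet_quadrant {n : ℕ} (S : Finset (Fin n)) : MeasurableSet (quadrant S) := by
  have : quadrant S = ⋂ k ∈ S, {z : Fin n → ℝ | z k < 0} := by ext; simp [quadrant]
  rw [this]
  exact Finset.measurableSet_biInter _ fun k _ => measurableSet_lt (measurable_pi_apply k) measurable_const

/-- The fundamental theorem of calculus on a quadrant. -/
theorem integral_quadrant_fderiv {n : ℕ} {f : (Fin (n + 1) → ℝ) → ℝ} (hf : ContDiff ℝ 1 f)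
    (hc : HasCompactSupport f) (S : Finset (Fin (n + 1))) (j : Fin (n + 1)) :
    ∫ z in quadrant S, fderiv ℝ f z (Pi.single j 1) =
      if j ∈ S then ∫ w in {w : Fin n → ℝ | ∀ k ∈ S, k ≠ j →
        (j.insertNth 0 w : Fin (n + 1) → ℝ) k < 0}, f (j.insertNth 0 w) else 0 := by
  set T : Set (Fin n → ℝ) := {w | ∀ k ∈ S, k ≠ j → (j.insertNth 0 w : Fin (n + 1) → ℝ) k < 0}
  have hT : MeasurableSet T := by
    have : T = ⋂ k ∈ S, ⋂ _ : k ≠ j,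
        {w : Fin n → ℝ | (j.insertNth 0 w : Fin (n + 1) → ℝ) k < 0} := by ext; simp [T]
    rw [this]
    refine Finset.measurableSet_biInter _ fun k _ => MeasurableSet.iInter fun hk => ?_
    obtain ⟨l, rfl⟩ := Fin.exists_succAbove_eq hk
    simpa using measurableSet_lt (measurable_pi_apply l) measurable_const
  -- A line in direction `j` misses the quadrant if `w ∉ T`. Otherwise it meets it in the half-line
  -- `r < 0` if `j ∈ S`, and lies wholly inside it if `j ∉ S`. Fubini then leaves a boundary value
  -- in the second case and zero in the third, by compact support.
  have hmem : ∀ (r : ℝ) (w : Fin n → ℝ), (j.insertNth r w : Fin (n + 1) → ℝ) ∈ quadrant S ↔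
      (j ∈ S → r < 0) ∧ w ∈ T := by
    intro r w
    constructor
    · intro h
      refine ⟨fun hj => by simpa using h j hj, fun k hk hkj => ?_⟩
      obtain ⟨l, rfl⟩ := Fin.exists_succAbove_eq hkj
      simpa using h _ hk
    · rintro ⟨h0, h⟩ k hk
      by_cases hkj : k = j
      · subst hkj; simpa using h0 hk
      · have := h k hk hkj
        obtain ⟨l, rfl⟩ := Fin.exists_succAbove_eq hkj
        simpa using this
  set F : (Fin (n + 1) → ℝ) → ℝ := fun z => fderiv ℝ f z (Pi.single j 1)
  have hFc : Continuous F := (hf.continuous_fderiv one_ne_zero).clm_apply continuous_const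
  have hFs : HasCompactSupport F := hc.fderiv_apply (𝕜 := ℝ) _
  have hFi : Integrable ((quadrant S).indicator F) :=
    (hFc.integrable_of_hasCompactSupport hFs).indicator (measurableSet_quadrant S)
  rw [← integral_indicator (measurableSet_quadrant S)]
  have mp := (volume_preserving_piFinSuccAbove (fun _ : Fin (n + 1) => ℝ) j).symm
  rw [← mp.integral_comp (MeasurableEquiv.measurableEmbedding _), Measure.volume_eq_prod,
    integral_prod_symm]
  swap
  · exact (mp.integrable_comp_emb (MeasurableEquiv.measurableEmbedding _)).2 hFi
  have hd : ∀ w, ∀ r, deriv (fun r : ℝ => f (j.insertNth r w)) r = F (j.insertNth r w) := by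
    intro w r
    have := ((hf.differentiable one_ne_zero) (j.insertNth r w)).hasFDerivAt.comp_hasDerivAt r
      (hasDerivAt_insertNth j w r)
    exact this.deriv
  have hs : ∀ w, ContDiff ℝ 1 (fun r : ℝ => f (j.insertNth r w)) := fun w =>
    hf.comp ((contDiff_insertNth j w).of_le (by norm_cast))
  have inner : ∀ w : Fin n → ℝ, (∫ r : ℝ, (quadrant S).indicator F
      ((MeasurableEquiv.piFinSuccAbove (fun _ : Fin (n + 1) => ℝ) j).symm (r, w))) =
      T.indicator (fun w => if j ∈ S then f (j.insertNth 0 w) else 0) w := by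
    intro w
    change (∫ r : ℝ, (quadrant S).indicator F (j.insertNth r w)) = _
    by_cases hw : w ∈ T
    · rw [indicator_of_mem hw]
      by_cases hj : j ∈ S
      · have : ∀ r : ℝ, (quadrant S).indicator F (j.insertNth r w) =
            (Iio (0 : ℝ)).indicator (deriv (fun r : ℝ => f (j.insertNth r w))) r := by
          intro r
          by_cases hr : r < 0
          · rw [indicator_of_mem ((hmem r w).2 ⟨fun _ => hr, hw⟩), indicator_of_mem (by exact hr), hd]
          · rw [indicator_of_notMem (fun h => hr (((hmem r w).1 h).1 hj)),
              indicator_of_notMem (by exact hr)]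
        simp_rw [this]
        rw [integral_indicator measurableSet_Iio, ← integral_Iic_eq_integral_Iio,
          (hasCompactSupport_comp_insertNth hc j w).integral_Iic_deriv_eq (hs w), if_pos hj]
      · have : ∀ r : ℝ, (quadrant S).indicator F (j.insertNth r w) =
            deriv (fun r : ℝ => f (j.insertNth r w)) r := by
          intro r
          rw [indicator_of_mem ((hmem r w).2 ⟨fun h => absurd h hj, hw⟩), hd]
        simp_rw [this]
        rw [if_neg hj]
        have hcs := hasCompactSupport_comp_insertNth hc j w
        exact integral_eq_zero_of_hasDerivAt_of_integrable
          (fun r => ((hs w).differentiable one_ne_zero r).hasDerivAt)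
          (((hs w).continuous_deriv le_rfl).integrable_of_hasCompactSupport hcs.deriv)
          ((hs w).continuous.integrable_of_hasCompactSupport hcs)
    · rw [indicator_of_notMem hw]
      have : ∀ r : ℝ, (quadrant S).indicator F (j.insertNth r w) = 0 := fun r =>
        indicator_of_notMem (fun h => hw ((hmem r w).1 h).2) _
      simp [this]
  refine (integral_congr_ae (Filter.Eventually.of_forall inner)).trans ?_
  rw [integral_indicator hT]
  split_ifs <;> simp

/-- The standard frame of `ℝ³`. -/
def frame : Fin 3 → Base := fun k => Pi.single k 1

/-- Stokes' theorem on a quadrant. -/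
theorem integral_quadrant_extDeriv {β : Base → Base [⋀^Fin 2]→L[ℝ] ℝ} (hβ : ContDiff ℝ 1 β)
    (hc : HasCompactSupport β) (S : Finset (Fin 3)) :
    ∫ z in quadrant S, extDeriv β z frame = ∑ j ∈ S, (-1 : ℝ) ^ (j : ℕ) *
      ∫ w in {w : Fin 2 → ℝ | ∀ k ∈ S, k ≠ j → (j.insertNth 0 w : Base) k < 0},
        β (j.insertNth 0 w) (fun k => Pi.single (j.succAbove k) 1) := by
  have hcomp : ∀ v, ContDiff ℝ 1 (fun z => β z v) := fun v =>
    (ContinuousAlternatingMap.apply ℝ Base ℝ v).contDiff.comp hβ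
  have hsupp : ∀ v, HasCompactSupport (fun z => β z v) := fun v =>
    hc.comp_left (g := fun b : Base [⋀^Fin 2]→L[ℝ] ℝ => b v) (by simp)
  have he : ∀ z, extDeriv β z frame = ∑ j : Fin 3, (-1 : ℝ) ^ (j : ℕ) *
      fderiv ℝ (fun z => β z (j.removeNth frame)) z (Pi.single j 1) := fun z => by
    rw [extDeriv_apply (hβ.differentiable one_ne_zero z)]
    simp [frame]
  simp_rw [he]
  rw [integral_finsetSum]
  · simp_rw [integral_const_mul]
    rw [← Finset.sum_filter_add_sum_filter_not Finset.univ (· ∈ S)]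
    rw [Finset.sum_eq_zero (s := Finset.univ.filter (· ∉ S)), add_zero]
    · refine Finset.sum_congr (by ext; simp) fun j hj => ?_
      rw [integral_quadrant_fderiv (hcomp _) (hsupp _), if_pos (by simpa using hj)]
      rfl
    · intro j hj
      rw [integral_quadrant_fderiv (hcomp _) (hsupp _), if_neg (by simpa using hj), mul_zero]
  · intro j _
    refine Integrable.const_mul (Integrable.integrableOn ?_) _
    exact (((hcomp _).continuous_fderiv one_ne_zero).clm_apply
      continuous_const).integrable_of_hasCompactSupport ((hsupp _).fderiv_apply (𝕜 := ℝ) _)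

end Stokes

/-! ### Pull-back of forms by charts, and Stokes' theorem from quadrants to corner domains -/

section Atlas

theorem form_ext {n : ℕ} {a b : Base [⋀^Fin n]→L[ℝ] ℝ}
    (h : ∀ i : Fin n → Fin 3, Function.Injective i → a (fun k => frame (i k)) = b (fun k => frame (i k))) :
    a = b := by
  apply ContinuousAlternatingMap.toAlternatingMap_injective
  refine Module.Basis.ext_alternating (Pi.basisFun ℝ (Fin 3)) fun v hv => ?_
  simpa [frame] using h v hv

/-- A form on `ℝ³` is as smooth as its components. -/
theorem contDiffAt_form {E : Type*} [NormedAddCommGroup E] [NormedSpace ℝ E] {m : WithTop ℕ∞} {n : ℕ}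
    {a : E → Base [⋀^Fin n]→L[ℝ] ℝ} {x : E}
    (h : ∀ i : Fin n → Fin 3, Function.Injective i → ContDiffAt ℝ m (fun y => a y fun k => frame (i k)) x) :
    ContDiffAt ℝ m a x := by
  -- Taking components is an injective linear map, so it has a linear left inverse `G`. Finite
  -- dimension makes `G` continuous, and it rebuilds the form smoothly from its components.
  let ι := {i : Fin n → Fin 3 // Function.Injective i}
  let L : (Base [⋀^Fin n]→L[ℝ] ℝ) →ₗ[ℝ] (ι → ℝ) :=
    { toFun := fun b i => b fun k => frame (i.1 k)
      map_add' := fun _ _ => rfl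
      map_smul' := fun _ _ => rfl }
  have hL : LinearMap.ker L = ⊥ := LinearMap.ker_eq_bot.2 fun b c hbc =>
    form_ext fun i hi => congrFun hbc ⟨i, hi⟩
  obtain ⟨G, hG⟩ := L.exists_leftInverse_of_injective hL
  have ha : a = fun y => G.toContinuousLinearMap (L (a y)) := by
    ext1 y
    exact (LinearMap.congr_fun hG (a y)).symm
  rw [ha]
  refine G.toContinuousLinearMap.contDiff.contDiffAt.comp x (contDiffAt_pi.2 fun i => h i.1 i.2)

/-- Composition is jointly analytic in the multilinear map and the linear maps inserted in its
slots. Testing on components allows this fact about multilinear maps to be used for alternating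
ones. -/
theorem contDiffAt_compContinuousLinearMap {E F : Type*} [NormedAddCommGroup E] [NormedSpace ℝ E]
    [NormedAddCommGroup F] [NormedSpace ℝ F] {m : WithTop ℕ∞} {n : ℕ}
    {a : E → F [⋀^Fin n]→L[ℝ] ℝ} {T : E → Base →L[ℝ] F} {x : E} (ha : ContDiffAt ℝ m a x)
    (hT : ContDiffAt ℝ m T x) :
    ContDiffAt ℝ m (fun y => (a y).compContinuousLinearMap (T y)) x := by
  refine contDiffAt_form fun i _ => ?_
  have h1 : ContDiffAt ℝ m (fun y => ((fun _ : Fin n => T y),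
      ContinuousAlternatingMap.toContinuousMultilinearMapCLM ℝ (a y))) x :=
    (contDiffAt_pi.2 fun _ => hT).prodMk
      ((ContinuousAlternatingMap.toContinuousMultilinearMapCLM
        ℝ : (F [⋀^Fin n]→L[ℝ] ℝ) →L[ℝ] _).contDiff.contDiffAt.comp x ha)
  have h2 := (ContinuousMultilinearMap.analyticAt_uncurry_compContinuousLinearMap
    (𝕜 := ℝ) (Fm := fun _ : Fin n => Base) (Em := fun _ : Fin n => F) (G := ℝ)
    (q := ((fun _ : Fin n => T x),
      ContinuousAlternatingMap.toContinuousMultilinearMapCLM ℝ (a x)))).contDiffAt (n := m)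
  have h3 := (ContinuousMultilinearMap.apply ℝ (fun _ : Fin n => Base) ℝ
    (fun k => frame (i k))).contDiff.contDiffAt.comp x (h2.comp x h1)
  exact h3

/-- The pull-back of the `2`-form `g` by the partial homeomorphism `f`, extended by zero. -/
def chartPullback (f : OpenPartialHomeomorph Base Base) (g : Base → Base [⋀^Fin 2]→L[ℝ] ℝ) :
    Base → Base [⋀^Fin 2]→L[ℝ] ℝ :=
  f.source.indicator (pullback f g)

variable {f : OpenPartialHomeomorph Base Base} {g : Base → Base [⋀^Fin 2]→L[ℝ] ℝ}

theorem isCompact_image_symm_tsupport (hc : HasCompactSupport g) (hs : tsupport g ⊆ f.target) :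
    IsCompact (f.symm '' tsupport g) :=
  hc.isCompact.image_of_continuousOn (f.continuousOn_symm.mono hs)

theorem chartPullback_eq_zero {z : Base} (hz : z ∉ f.symm '' tsupport g) :
    chartPullback f g z = 0 := by
  by_cases h : z ∈ f.source
  · have : g (f z) = 0 := by
      by_contra h0
      exact hz ⟨f z, subset_tsupport g h0, f.left_inv h⟩
    rw [chartPullback, indicator_of_mem h, pullback, this]
    ext; simp
  · exact indicator_of_notMem h _

theorem chartPullback_eventuallyEq {z : Base} (hz : z ∈ f.source) :
    chartPullback f g =ᶠ[nhds z] pullback f g :=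
  Filter.eventuallyEq_of_mem (f.open_source.mem_nhds hz) fun _ hy => indicator_of_mem hy _

/-- The inverse chart carries the support of `g` to a compact, hence closed, subset of the source,
whose complement is a neighbourhood of every point outside the source. This makes the extension by
zero smooth across the edge of the chart. -/
theorem chartPullback_eventuallyEq_zero (hc : HasCompactSupport g) (hs : tsupport g ⊆ f.target)
    {z : Base} (hz : z ∉ f.source) : chartPullback f g =ᶠ[nhds z] 0 := by
  have hK := isCompact_image_symm_tsupport hc hs
  have hzK : z ∉ f.symm '' tsupport g := by
    rintro ⟨y, hy, rfl⟩
    exact hz (f.map_target (hs hy))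
  exact Filter.eventuallyEq_of_mem (hK.isClosed.isOpen_compl.mem_nhds hzK)
    fun _ hy => chartPullback_eq_zero hy

theorem hasCompactSupport_chartPullback (hc : HasCompactSupport g) (hs : tsupport g ⊆ f.target) :
    HasCompactSupport (chartPullback f g) :=
  HasCompactSupport.intro (isCompact_image_symm_tsupport hc hs) fun _ => chartPullback_eq_zero

theorem contDiff_chartPullback (hf : ContDiffOn ℝ 2 f f.source) (hg : ContDiff ℝ 1 g)
    (hc : HasCompactSupport g) (hs : tsupport g ⊆ f.target) :
    ContDiff ℝ 1 (chartPullback f g) := by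
  rw [contDiff_iff_contDiffAt]
  intro z
  by_cases hz : z ∈ f.source
  · refine ContDiffAt.congr_of_eventuallyEq ?_ (chartPullback_eventuallyEq hz)
    have hfz : ContDiffAt ℝ 2 f z := hf.contDiffAt (f.open_source.mem_nhds hz)
    have h1 : ContDiffAt ℝ 1 (fun z => g (f z)) z :=
      hg.contDiffAt.comp z (hfz.of_le one_le_two)
    have h2 : ContDiffAt ℝ 1 (fderiv ℝ f) z := hfz.fderiv_right (by norm_num)
    exact contDiffAt_compContinuousLinearMap h1 h2
  · exact contDiffAt_const.congr_of_eventuallyEq (chartPullback_eventuallyEq_zero hc hs hz)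

/-- Naturality of `d` under a `C²` map, together with the fact that every 3-form on `ℝ³` is a
multiple of the determinant. -/
theorem extDeriv_chartPullback (hf : ContDiffOn ℝ 2 f f.source) (hg : ContDiff ℝ 1 g)
    {z : Base} (hz : z ∈ f.source) :
    extDeriv (chartPullback f g) z frame = (fderiv ℝ f z).det * extDeriv g (f z) frame := by
  rw [(chartPullback_eventuallyEq hz).extDeriv_eq]
  have hfz : ContDiffAt ℝ 2 f z := hf.contDiffAt (f.open_source.mem_nhds hz)
  have := extDeriv_pullback (hg.differentiable one_ne_zero (f z)) hfz (by simp)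
  change extDeriv (fun x ↦ (g (f x)).compContinuousLinearMap (fderiv ℝ f x)) z frame = _
  rw [this]
  have e := ((extDeriv g (f z)).toAlternatingMap).eq_smul_basis_det (Pi.basisFun ℝ (Fin 3))
  have hfr : ⇑(Pi.basisFun ℝ (Fin 3)) = frame := by ext; simp [frame]
  have e' : ∀ v, extDeriv g (f z) v = extDeriv g (f z) frame * (Pi.basisFun ℝ (Fin 3)).det v := by
    intro v
    have := congrArg (fun a => a v) e
    simpa [hfr] using this
  rw [ContinuousAlternatingMap.compContinuousLinearMap_apply, e']
  rw [mul_comm, ← hfr]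
  congr 1
  have := Module.Basis.det_comp (Pi.basisFun ℝ (Fin 3)) (fderiv ℝ f z : Base →ₗ[ℝ] Base)
    (Pi.basisFun ℝ (Fin 3))
  rw [Module.Basis.det_self, mul_one] at this
  exact this

theorem extDeriv_eq_zero_of_notMem_tsupport {p : Base} (hp : p ∉ tsupport g) :
    extDeriv g p = 0 := by
  have : g =ᶠ[nhds p] 0 := notMem_tsupport_iff_eventuallyEq.1 hp
  rw [this.extDeriv_eq]
  ext v
  simp [extDeriv, ContinuousAlternatingMap.alternatizeUncurryFin_apply]

/-- Change of variables. The two integrands vanish off the source and off the target of the chart,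
and the positive Jacobian equals its absolute value. -/
theorem integral_quadrant_extDeriv_chartPullback (hf : ContDiffOn ℝ 2 f f.source)
    (hdet : ∀ z ∈ f.source, 0 < (fderiv ℝ f z).det) {U : Set Base} (hU : MeasurableSet U)
    {S : Finset (Fin 3)} (hS : ∀ z ∈ f.source, f z ∈ U ↔ z ∈ quadrant S)
    (hg : ContDiff ℝ 1 g) (hc : HasCompactSupport g) (hs : tsupport g ⊆ f.target) :
    ∫ z in quadrant S, extDeriv (chartPullback f g) z frame = ∫ p in U, extDeriv g p frame := by
  have hm := f.open_source.measurableSet.inter (measurableSet_quadrant S)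
  have himg : f '' (f.source ∩ quadrant S) = f.target ∩ U := by
    ext p
    constructor
    · rintro ⟨z, ⟨hz, hq⟩, rfl⟩
      exact ⟨f.map_source hz, (hS z hz).2 hq⟩
    · rintro ⟨hp, hpU⟩
      have := f.map_target hp
      exact ⟨f.symm p, ⟨this, (hS _ this).1 (by rwa [f.right_inv hp])⟩, f.right_inv hp⟩
  calc ∫ z in quadrant S, extDeriv (chartPullback f g) z frame
      = ∫ z in f.source ∩ quadrant S, extDeriv (chartPullback f g) z frame := by
        refine setIntegral_eq_of_subset_of_forall_sdiff_eq_zero (measurableSet_quadrant S)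
          inter_subset_right fun z hz => ?_
        have hz' : z ∉ f.source := fun h => hz.2 ⟨h, hz.1⟩
        rw [(chartPullback_eventuallyEq_zero hc hs hz').extDeriv_eq]
        simp [extDeriv, ContinuousAlternatingMap.alternatizeUncurryFin_apply]
    _ = ∫ z in f.source ∩ quadrant S, |(fderiv ℝ f z).det| • extDeriv g (f z) frame := by
        refine setIntegral_congr_fun hm fun z hz => ?_
        simp only [smul_eq_mul]
        rw [extDeriv_chartPullback hf hg hz.1, abs_of_pos (hdet z hz.1)]
    _ = ∫ p in f.target ∩ U, extDeriv g p frame := by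
        rw [← himg, integral_image_eq_integral_abs_det_fderiv_smul volume hm
          (fun z hz => ?_) (f.injOn.mono inter_subset_left)]
        exact ((hf.contDiffAt (f.open_source.mem_nhds hz.1)).differentiableAt
          two_ne_zero).hasFDerivAt.hasFDerivWithinAt
    _ = ∫ p in U, extDeriv g p frame := by
        symm
        refine setIntegral_eq_of_subset_of_forall_sdiff_eq_zero hU
          inter_subset_right fun p hp => ?_
        rw [extDeriv_eq_zero_of_notMem_tsupport fun h => hp.2 ⟨hs h, hp.1⟩]
        simp

/-- Multiplication by `χ` turns a form that is `C¹` only on `X` into one that is `C¹` everywhere,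
without changing it on `K`; this is applied with `K = closure U`. -/
theorem exists_cutoff {E : Type*} [NormedAddCommGroup E] [NormedSpace ℝ E] [FiniteDimensional ℝ E]
    {K X : Set E} (hK : IsClosed K) (hX : IsOpen X) (h : K ⊆ X) :
    ∃ χ : E → ℝ, ContDiff ℝ 1 χ ∧ tsupport χ ⊆ X ∧ ∀ p ∈ K, χ p = 1 := by
  obtain ⟨W, hW, hKW, hWX⟩ := normal_exists_closure_subset hK hX h
  obtain ⟨χ, hχ, -, hs, h1⟩ := exists_contMDiff_support_eq_eq_one_iff
    (n := 1) (modelWithCornersSelf ℝ E) hW hK hKW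
  refine ⟨χ, hχ.contDiff, ?_, fun p hp => (h1 p).1 hp⟩
  rwa [tsupport, hs]

/-- Subtracting a small `ε > 0` from all coordinates moves a point of the closed quadrant into the
open one. It is needed on the faces, because the cutoff is known to equal `1` only on `closure U`.
-/
theorem CornerAtlas.mem_closure {U : Set Base} (A : CornerAtlas U) (i : Fin A.n) {z : Base}
    (hz : z ∈ (A.chart i).source) (h : ∀ j ∈ A.S i, z j ≤ 0) : A.chart i z ∈ closure U := by
  have hc : ContinuousAt (fun ε : ℝ => A.chart i (z - fun _ => ε)) 0 := by
    refine ContinuousAt.comp (g := A.chart i) ?_ (by fun_prop)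
    have : z - (fun _ : Fin 3 => (0 : ℝ)) = z := sub_zero z
    rw [this]
    exact (A.chart i).continuousAt hz
  have ht : Filter.Tendsto (fun ε : ℝ => A.chart i (z - fun _ => ε)) (nhdsWithin 0 (Ioi 0))
      (nhds (A.chart i z)) := by
    have := hc.tendsto.mono_left (nhdsWithin_le_nhds (s := Ioi (0 : ℝ)))
    rwa [show z - (fun _ : Fin 3 => (0 : ℝ)) = z from sub_zero z] at this
  have hs : ∀ᶠ ε : ℝ in nhdsWithin 0 (Ioi 0), (z - fun _ => ε) ∈ (A.chart i).source := by
    have : ContinuousAt (fun ε : ℝ => (z - fun _ => ε : Base)) 0 := by fun_prop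
    refine (this.eventually_mem ?_).filter_mono nhdsWithin_le_nhds
    have h0 : z - (fun _ : Fin 3 => (0 : ℝ)) = z := sub_zero z
    rw [h0]
    exact (A.chart i).open_source.mem_nhds hz
  refine mem_closure_of_tendsto ht ?_
  filter_upwards [hs, self_mem_nhdsWithin] with ε hε hpos
  rw [A.mem_iff i _ hε]
  intro j hj
  have := h j hj
  simp only [mem_Ioi] at hpos
  simp only [Pi.sub_apply]
  linarith

/-- **Stokes' theorem** on a domain with corners. -/
theorem CornerAtlas.boundaryIntegral_eq {U X : Set Base} (hU : IsOpen U) (hX : IsOpen X)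
    (hUX : closure U ⊆ X) (A : CornerAtlas U) {α : Base → Base [⋀^Fin 2]→L[ℝ] ℝ}
    (hα : ContDiffOn ℝ 1 α X) :
    A.boundaryIntegral α = ∫ p in U, extDeriv α p frame := by
  obtain ⟨χ, hχ, hχs, hχ1⟩ := exists_cutoff isClosed_closure hX hUX
  set g : Fin A.n → Base → Base [⋀^Fin 2]→L[ℝ] ℝ := fun i p => (A.rho i p * χ p) • α p with hg_def
  have hg : ∀ i, ContDiff ℝ 1 (g i) := by
    intro i
    rw [contDiff_iff_contDiffAt]
    intro p
    by_cases hp : p ∈ X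
    · exact ((A.contDiff_rho i).contDiffAt.mul hχ.contDiffAt).smul
        (hα.contDiffAt (hX.mem_nhds hp))
    · have h0 : χ =ᶠ[nhds p] 0 := notMem_tsupport_iff_eventuallyEq.1 fun h => hp (hχs h)
      refine (contDiffAt_const (c := 0)).congr_of_eventuallyEq ?_
      filter_upwards [h0] with q hq
      simp [hg_def, hq]
  have hts : ∀ i, tsupport (g i) ⊆ tsupport (A.rho i) := by
    intro i
    refine closure_mono fun p hp h => hp ?_
    simp only [hg_def, h, zero_mul, zero_smul]
  have hc : ∀ i, HasCompactSupport (g i) := fun i =>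
    (A.hasCompactSupport_rho i).of_isClosed_subset (isClosed_tsupport _) (hts i)
  have ht : ∀ i, tsupport (g i) ⊆ (A.chart i).target := fun i => (hts i).trans (A.tsupport_rho i)
  have hchart : ∀ i, (∑ j ∈ A.S i, (-1 : ℝ) ^ (j : ℕ) *
      ∫ w in {w : Fin 2 → ℝ | j.insertNth 0 w ∈ (A.chart i).source ∧
        ∀ k ∈ A.S i, k ≠ j → (j.insertNth 0 w : Base) k < 0},
      A.rho i (A.chart i (j.insertNth 0 w)) *
        pullback (A.chart i) α (j.insertNth 0 w) (fun k => Pi.single (j.succAbove k) 1)) =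
      ∫ p in U, extDeriv (g i) p frame := by
    intro i
    rw [← integral_quadrant_extDeriv_chartPullback (A.contDiffOn_chart i) (A.det_pos i)
      hU.measurableSet (A.mem_iff i) (hg i) (hc i) (ht i),
      integral_quadrant_extDeriv (contDiff_chartPullback (A.contDiffOn_chart i) (hg i) (hc i) (ht i))
        (hasCompactSupport_chartPullback (hc i) (ht i))]
    refine Finset.sum_congr rfl fun j hj => ?_
    congr 1
    have hins : Continuous fun w : Fin 2 → ℝ => (j.insertNth 0 w : Base) := by fun_prop
    have hmT : MeasurableSet
        {w : Fin 2 → ℝ | ∀ k ∈ A.S i, k ≠ j → (j.insertNth 0 w : Base) k < 0} := by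
      have : {w : Fin 2 → ℝ | ∀ k ∈ A.S i, k ≠ j → (j.insertNth 0 w : Base) k < 0} =
          (fun w : Fin 2 → ℝ => (j.insertNth 0 w : Base)) ⁻¹' quadrant ((A.S i).erase j) := by
        ext; simp [quadrant]; tauto
      rw [this]
      exact hins.measurable (measurableSet_quadrant _)
    have hmS : MeasurableSet {w : Fin 2 → ℝ | (j.insertNth 0 w : Base) ∈ (A.chart i).source} :=
      ((A.chart i).open_source.preimage hins).measurableSet
    -- Face points outside the chart's source contribute nothing, since the pull-back is extended by
    -- zero there.
    rw [setIntegral_eq_of_subset_of_forall_sdiff_eq_zero (s := _ ∩ _) hmT inter_subset_right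
      (fun w hw => ?_)]
    · refine setIntegral_congr_fun (hmS.inter hmT) fun w hw => ?_
      obtain ⟨hw, hwS⟩ := hw
      have hcl : A.chart i (j.insertNth 0 w) ∈ closure U := by
        refine A.mem_closure i hw fun k hk => ?_
        by_cases hkj : k = j
        · subst hkj; simp
        · exact (hwS k hk hkj).le
      simp only [chartPullback]
      rw [indicator_of_mem (by exact hw)]
      simp [pullback, hg_def, hχ1 _ hcl]
    · have : (j.insertNth 0 w : Base) ∉ (A.chart i).source := fun h => hw.2 ⟨h, hw.1⟩
      rw [chartPullback, indicator_of_notMem this]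
      simp
  rw [CornerAtlas.boundaryIntegral, Finset.sum_congr rfl fun i _ => hchart i, ← integral_finsetSum]
  · refine setIntegral_congr_fun hU.measurableSet fun p hp => ?_
    -- The identity holds on a neighbourhood of `p`, so it may be differentiated and the derivatives
    -- of the cutoffs never appear separately.
    have hloc : α =ᶠ[nhds p] fun q => ∑ i, g i q := by
      filter_upwards [hU.mem_nhds hp] with q hq
      simp only [hg_def, hχ1 q (subset_closure hq), mul_one, ← Finset.sum_smul,
        A.sum_rho q (subset_closure hq), one_smul]
    simp only [hloc.extDeriv_eq]
    rw [extDeriv, fderiv_fun_sum fun i _ => (hg i).differentiable one_ne_zero p]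
    simp [extDeriv, ContinuousAlternatingMap.alternatizeUncurryFin_apply, Finset.smul_sum]
    exact Finset.sum_comm
  · intro i _
    refine Integrable.integrableOn (Continuous.integrable_of_hasCompactSupport ?_ ?_)
    · have : ∀ p, extDeriv (g i) p frame = ContinuousAlternatingMap.apply ℝ Base ℝ frame
          (ContinuousAlternatingMap.alternatizeUncurryFinCLM ℝ Base ℝ (fderiv ℝ (g i) p)) :=
        fun p => rfl
      simp_rw [this]
      exact (ContinuousLinearMap.continuous _).comp ((ContinuousLinearMap.continuous _).comp
        ((hg i).continuous_fderiv one_ne_zero))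
    · refine HasCompactSupport.intro (hc i).isCompact fun p hp => ?_
      rw [extDeriv_eq_zero_of_notMem_tsupport hp]
      simp

end Atlas

section Derivatives

/-! ### Iterated directional derivatives -/

section Directional

variable {E : Type*} [NormedAddCommGroup E] [NormedSpace ℝ E]

/-- The derivative of `f` in the direction `v`. -/
def dirDeriv (v : E) (f : E → ℝ) (x : E) : ℝ := fderiv ℝ f x v

variable {O : Set E} {f g : E → ℝ}

theorem contDiffOn_dirDeriv (hO : IsOpen O) (hf : ContDiffOn ℝ ∞ f O) (v : E) :
    ContDiffOn ℝ ∞ (dirDeriv v f) O :=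
  (hf.fderiv_of_isOpen hO (m := ∞) (by simp)).clm_apply contDiffOn_const

theorem eqOn_dirDeriv (hO : IsOpen O) (h : EqOn f g O) (v : E) :
    EqOn (dirDeriv v f) (dirDeriv v g) O := fun x hx => by
  have : f =ᶠ[nhds x] g := Filter.eventuallyEq_of_mem (hO.mem_nhds hx) h
  simp only [dirDeriv, this.fderiv_eq]

theorem dirDeriv_comm (hO : IsOpen O) (hf : ContDiffOn ℝ ∞ f O) (v w : E) :
    EqOn (dirDeriv v (dirDeriv w f)) (dirDeriv w (dirDeriv v f)) O := by
  intro x hx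
  have hfx : ContDiffAt ℝ ∞ f x := hf.contDiffAt (hO.mem_nhds hx)
  have hd : DifferentiableAt ℝ (fderiv ℝ f) x :=
    (hfx.fderiv_right (m := ∞) (by simp)).differentiableAt (by simp)
  have key : ∀ a b : E, dirDeriv a (dirDeriv b f) x = fderiv ℝ (fderiv ℝ f) x a b := by
    intro a b
    have := (hd.hasFDerivAt.clm_apply (hasFDerivAt_const b x)).fderiv
    change fderiv ℝ (fun y => fderiv ℝ f y b) x a = _
    rw [this]
    simp
  rw [key, key]
  have h2 : ((2 : ℕ) : WithTop ℕ∞) ≤ ∞ := WithTop.coe_le_coe.2 le_top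
  exact (hfx.isSymmSndFDerivAt (by simpa using h2)).eq v w

theorem contDiffOn_iterate_dirDeriv (hO : IsOpen O) (hf : ContDiffOn ℝ ∞ f O) (v : E) (n : ℕ) :
    ContDiffOn ℝ ∞ ((dirDeriv v)^[n] f) O := by
  induction n with
  | zero => exact hf
  | succ n ih => rw [Function.iterate_succ_apply']; exact contDiffOn_dirDeriv hO ih v

theorem eqOn_iterate_dirDeriv (hO : IsOpen O) (h : EqOn f g O) (v : E) (n : ℕ) :
    EqOn ((dirDeriv v)^[n] f) ((dirDeriv v)^[n] g) O := by
  induction n with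
  | zero => exact h
  | succ n ih =>
    rw [Function.iterate_succ_apply', Function.iterate_succ_apply']; exact eqOn_dirDeriv hO ih v

theorem dirDeriv_iterate_comm (hO : IsOpen O) (hf : ContDiffOn ℝ ∞ f O) (v w : E) (n : ℕ) :
    EqOn (dirDeriv v ((dirDeriv w)^[n] f)) ((dirDeriv w)^[n] (dirDeriv v f)) O := by
  induction n with
  | zero => exact fun _ _ => rfl
  | succ n ih =>
    rw [Function.iterate_succ_apply', Function.iterate_succ_apply']
    exact (dirDeriv_comm hO (contDiffOn_iterate_dirDeriv hO hf w n) v w).trans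
      (eqOn_dirDeriv hO ih w)

/-- The mixed derivative of order `(a, b, c)` in the directions `u, v, w`. -/
def mixedDeriv (u v w : E) (a b c : ℕ) (f : E → ℝ) : E → ℝ :=
  (dirDeriv u)^[a] ((dirDeriv v)^[b] ((dirDeriv w)^[c] f))

variable (u v w : E) (a b c : ℕ)

theorem contDiffOn_mixedDeriv (hO : IsOpen O) (hf : ContDiffOn ℝ ∞ f O) :
    ContDiffOn ℝ ∞ (mixedDeriv u v w a b c f) O :=
  contDiffOn_iterate_dirDeriv hO (contDiffOn_iterate_dirDeriv hO
    (contDiffOn_iterate_dirDeriv hO hf _ _) _ _) _ _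

theorem eqOn_mixedDeriv (hO : IsOpen O) (h : EqOn f g O) :
    EqOn (mixedDeriv u v w a b c f) (mixedDeriv u v w a b c g) O :=
  eqOn_iterate_dirDeriv hO (eqOn_iterate_dirDeriv hO (eqOn_iterate_dirDeriv hO h _ _) _ _) _ _

theorem dirDeriv_mixedDeriv (hO : IsOpen O) (hf : ContDiffOn ℝ ∞ f O) (e : E) :
    EqOn (dirDeriv e (mixedDeriv u v w a b c f)) (mixedDeriv u v w a b c (dirDeriv e f)) O := by
  have hw := contDiffOn_iterate_dirDeriv hO hf w c
  have hv := contDiffOn_iterate_dirDeriv hO hw v b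
  exact (dirDeriv_iterate_comm hO hv e u a).trans
    (eqOn_iterate_dirDeriv hO ((dirDeriv_iterate_comm hO hw e v b).trans
      (eqOn_iterate_dirDeriv hO (dirDeriv_iterate_comm hO hf e w c) _ _)) _ _)

theorem dirDeriv_mixedDeriv_fst :
    dirDeriv u (mixedDeriv u v w a b c f) = mixedDeriv u v w (a + 1) b c f :=
  (Function.iterate_succ_apply' _ _ _).symm

theorem dirDeriv_mixedDeriv_snd (hO : IsOpen O) (hf : ContDiffOn ℝ ∞ f O) :
    EqOn (dirDeriv v (mixedDeriv u v w a b c f)) (mixedDeriv u v w a (b + 1) c f) O := by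
  have hw := contDiffOn_iterate_dirDeriv hO hf w c
  have hv := contDiffOn_iterate_dirDeriv hO hw v b
  refine (dirDeriv_iterate_comm hO hv v u a).trans ?_
  rw [mixedDeriv, Function.iterate_succ_apply']
  exact fun _ _ => rfl

theorem dirDeriv_mixedDeriv_trd (hO : IsOpen O) (hf : ContDiffOn ℝ ∞ f O) :
    EqOn (dirDeriv w (mixedDeriv u v w a b c f)) (mixedDeriv u v w a b (c + 1) f) O := by
  refine (dirDeriv_mixedDeriv u v w a b c hO hf w).trans ?_
  rw [mixedDeriv, mixedDeriv, Function.iterate_succ_apply]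
  exact fun _ _ => rfl

end Directional

/-- The partial derivative `∂ₓᵃ ∂ᵧᵇ ∂ₜᶜ f`. -/
def pderiv (a b c : ℕ) (f : Base → ℝ) : Base → ℝ :=
  mixedDeriv (Pi.single 0 1) (Pi.single 1 1) (Pi.single 2 1) a b c f

theorem pdJ_eq (J : Idx) (f : Base → ℝ) : pdJ J f = pderiv (J.1 0) (J.1 1) (J.1 2) f := rfl

variable {X : Set Base} {f g : Base → ℝ}

theorem contDiffOn_pd (hX : IsOpen X) (hf : ContDiffOn ℝ ∞ f X) (i : Fin 3) :
    ContDiffOn ℝ ∞ (pd i f) X := contDiffOn_dirDeriv hX hf _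

theorem contDiffOn_pderiv (hX : IsOpen X) (hf : ContDiffOn ℝ ∞ f X) (a b c : ℕ) :
    ContDiffOn ℝ ∞ (pderiv a b c f) X := contDiffOn_mixedDeriv _ _ _ a b c hX hf

theorem eqOn_pderiv (hX : IsOpen X) (h : EqOn f g X) (a b c : ℕ) :
    EqOn (pderiv a b c f) (pderiv a b c g) X := eqOn_mixedDeriv _ _ _ a b c hX h

theorem pd_zero_pderiv (a b c : ℕ) : pd 0 (pderiv a b c f) = pderiv (a + 1) b c f :=
  dirDeriv_mixedDeriv_fst _ _ _ a b c

theorem pd_one_pderiv (hX : IsOpen X) (hf : ContDiffOn ℝ ∞ f X) (a b c : ℕ) :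
    EqOn (pd 1 (pderiv a b c f)) (pderiv a (b + 1) c f) X :=
  dirDeriv_mixedDeriv_snd _ _ _ a b c hX hf

theorem pd_two_pderiv (hX : IsOpen X) (hf : ContDiffOn ℝ ∞ f X) (a b c : ℕ) :
    EqOn (pd 2 (pderiv a b c f)) (pderiv a b (c + 1) f) X :=
  dirDeriv_mixedDeriv_trd _ _ _ a b c hX hf

theorem pderiv_pd (hX : IsOpen X) (hf : ContDiffOn ℝ ∞ f X) (a b c : ℕ) (i : Fin 3) :
    EqOn (pderiv a b c (pd i f)) (pd i (pderiv a b c f)) X :=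
  (dirDeriv_mixedDeriv _ _ _ a b c hX hf _).symm

/-! ### Jets and iterated derivatives -/

/-- Evaluation at a fixed vector is continuous linear, so it commutes with the remaining `k`
differentiations. This drives both inductions comparing partial derivatives with full ones. -/
theorem iteratedFDeriv_pd (hX : IsOpen X) (hf : ContDiffOn ℝ ∞ f X) {p : Base} (hp : p ∈ X)
    (i : Fin 3) (k : ℕ) (m : Fin k → Base) :
    iteratedFDeriv ℝ k (pd i f) p m =
      iteratedFDeriv ℝ (k + 1) f p (Fin.snoc (α := fun _ => Base) m (Pi.single i 1)) := by
  have hfx : ContDiffAt ℝ ∞ f p := hf.contDiffAt (hX.mem_nhds hp)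
  have hd : ContDiffAt ℝ ∞ (fderiv ℝ f) p := hfx.fderiv_right (m := ∞) (by simp)
  have := (ContinuousLinearMap.apply ℝ ℝ (Pi.single i 1 : Base)).iteratedFDeriv_comp_left hd
    (i := k) (by exact_mod_cast le_top)
  rw [iteratedFDeriv_succ_apply_right]
  simp only [Fin.init_snoc, Fin.snoc_last]
  change iteratedFDeriv ℝ k (ContinuousLinearMap.apply ℝ ℝ (Pi.single i 1 : Base) ∘ fderiv ℝ f) p m = _
  rw [this]
  rfl

/-- Smooth functions with the same partial derivatives up to order `n` at a point have the same
iterated derivatives up to order `n`. -/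
theorem iteratedFDeriv_eq_of_pderiv_eq (hX : IsOpen X) {p : Base} (hp : p ∈ X) (n : ℕ) :
    ∀ {f g : Base → ℝ}, ContDiffOn ℝ ∞ f X → ContDiffOn ℝ ∞ g X →
      (∀ a b c, a + b + c ≤ n → pderiv a b c f p = pderiv a b c g p) →
      ∀ k ≤ n, iteratedFDeriv ℝ k f p = iteratedFDeriv ℝ k g p := by
  induction n with
  | zero =>
    intro f g _ _ h k hk
    obtain rfl : k = 0 := by omega
    ext m
    simpa using! h 0 0 0 le_rfl
  | succ n ih =>
    intro f g hf hg h k hk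
    rcases k with _ | k
    · ext m
      simpa using! h 0 0 0 (by omega)
    · have key : ∀ i : Fin 3, iteratedFDeriv ℝ k (pd i f) p = iteratedFDeriv ℝ k (pd i g) p := by
        intro i
        refine ih (contDiffOn_pd hX hf _) (contDiffOn_pd hX hg _) ?_ k (by omega)
        intro a b c habc
        rw [pderiv_pd hX hf a b c i hp, pderiv_pd hX hg a b c i hp]
        fin_cases i
        · simp only [Fin.zero_eta, pd_zero_pderiv]
          exact h _ _ _ (by omega)
        · simp only [Fin.mk_one, pd_one_pderiv hX hf a b c hp, pd_one_pderiv hX hg a b c hp]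
          exact h _ _ _ (by omega)
        · simp only [Fin.reduceFinMk, pd_two_pderiv hX hf a b c hp, pd_two_pderiv hX hg a b c hp]
          exact h _ _ _ (by omega)
      -- It is enough to compare on tuples of basis vectors; the last entry of such a tuple is
      -- absorbed into a partial derivative, where `key` applies.
      apply ContinuousMultilinearMap.toMultilinearMap_injective
      refine Module.Basis.ext_multilinear (fun _ => Pi.basisFun ℝ (Fin 3)) fun v => ?_
      have := congrArg (fun A => A (Fin.init fun i => Pi.basisFun ℝ (Fin 3) (v i))) (key (v (Fin.last k)))
      simp only [iteratedFDeriv_pd hX hf hp, iteratedFDeriv_pd hX hg hp] at this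
      have hv : (Fin.snoc (α := fun _ => Base) (Fin.init fun i => Pi.basisFun ℝ (Fin 3) (v i))
          (Pi.single (v (Fin.last k)) 1)) = fun i => Pi.basisFun ℝ (Fin 3) (v i) := by
        rw [← Pi.basisFun_apply]
        exact Fin.snoc_init_self (α := fun _ => Base) _
      rw [hv] at this
      exact this

/-- The converse of `iteratedFDeriv_eq_of_pderiv_eq`. -/
theorem pderiv_eq_of_iteratedFDeriv_eq (hX : IsOpen X) {p : Base} (hp : p ∈ X) :
    ∀ (n : ℕ) {f g : Base → ℝ}, ContDiffOn ℝ ∞ f X → ContDiffOn ℝ ∞ g X →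
      (∀ k ≤ n, iteratedFDeriv ℝ k f p = iteratedFDeriv ℝ k g p) →
      ∀ a b c, a + b + c ≤ n → pderiv a b c f p = pderiv a b c g p := by
  intro n
  induction n with
  | zero =>
    intro f g _ _ h a b c habc
    obtain ⟨rfl, rfl, rfl⟩ : a = 0 ∧ b = 0 ∧ c = 0 := by omega
    have := congrArg (fun A => A 0) (h 0 le_rfl)
    simpa using! this
  | succ n ih =>
    intro f g hf hg h a b c habc
    have key : ∀ (i : Fin 3) (a b c : ℕ), a + b + c ≤ n →
        pd i (pderiv a b c f) p = pd i (pderiv a b c g) p := by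
      intro i a b c habc
      rw [← pderiv_pd hX hf a b c i hp, ← pderiv_pd hX hg a b c i hp]
      refine ih (contDiffOn_pd hX hf _) (contDiffOn_pd hX hg _) (fun k hk => ?_) a b c habc
      ext m
      rw [iteratedFDeriv_pd hX hf hp, iteratedFDeriv_pd hX hg hp, h (k + 1) (by omega)]
    rcases a with _ | a
    · rcases b with _ | b
      · rcases c with _ | c
        · have := congrArg (fun A => A 0) (h 0 (by omega))
          simpa using! this
        · rw [← pd_two_pderiv hX hf _ _ _ hp, ← pd_two_pderiv hX hg _ _ _ hp]
          exact key _ _ _ _ (by omega)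
      · rw [← pd_one_pderiv hX hf _ _ _ hp, ← pd_one_pderiv hX hg _ _ _ hp]
        exact key _ _ _ _ (by omega)
    · rw [← pd_zero_pderiv, ← pd_zero_pderiv]
      exact key _ _ _ _ (by omega)

end Derivatives

section Prolongation

/-! ### The jet of the Taylor polynomial -/

/-- The `a`-th derivative of `x ^ j / j!`. -/
def divPow (j a : ℕ) (x : ℝ) : ℝ := if a ≤ j then x ^ (j - a) / (Nat.factorial (j - a) : ℝ) else 0

theorem hasDerivAt_divPow (j a : ℕ) (x : ℝ) : HasDerivAt (divPow j a) (divPow j (a + 1) x) x := by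
  by_cases h : a + 1 ≤ j
  · obtain ⟨m, rfl⟩ := Nat.exists_eq_add_of_le h
    have h1 : divPow (a + 1 + m) a = fun x => x ^ (m + 1) / (Nat.factorial (m + 1) : ℝ) := by
      ext x
      rw [divPow, if_pos (by omega), show a + 1 + m - a = m + 1 by omega]
    rw [h1, divPow, if_pos h, show a + 1 + m - (a + 1) = m by omega]
    refine ((hasDerivAt_pow (m + 1) x).div_const _).congr_deriv ?_
    rw [Nat.factorial_succ]
    have : (Nat.factorial m : ℝ) ≠ 0 := by positivity
    push_cast
    field_simp
  · rw [divPow, if_neg h]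
    by_cases h' : a ≤ j
    · have : divPow j a = fun _ => 1 := by
        ext x
        simp [divPow, h', show j - a = 0 by omega]
      rw [this]
      exact hasDerivAt_const _ _
    · have : divPow j a = fun _ => 0 := by
        ext x
        simp [divPow, h']
      rw [this]
      exact hasDerivAt_const _ _

theorem divPow_zero (j a : ℕ) : divPow j a 0 = if a = j then 1 else 0 := by
  rcases lt_trichotomy a j with h | h | h
  · rw [divPow, if_pos h.le, if_neg h.ne, zero_pow (by omega), zero_div]
  · simp [divPow, h]
  · rw [divPow, if_neg (by omega), if_neg (by omega)]

/-- The expected value of `∂ₓᵃ ∂ᵧᵇ ∂ₜᶜ (taylor z)`. -/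
def taylorDeriv (z : J5) (a b c : ℕ) (q : Base) : ℝ :=
  ∑ J : Idx, z.2 J * (divPow (J.1 0) a (q 0 - z.1 0) * divPow (J.1 1) b (q 1 - z.1 1) *
    divPow (J.1 2) c (q 2 - z.1 2))

theorem hasFDerivAt_divPow_coord (j a : ℕ) (i : Fin 3) (p q : Base) :
    HasFDerivAt (fun q : Base => divPow j a (q i - p i))
      (divPow j (a + 1) (q i - p i) • (ContinuousLinearMap.proj i : Base →L[ℝ] ℝ)) q := by
  have h : HasFDerivAt (fun q : Base => q i - p i) (ContinuousLinearMap.proj i : Base →L[ℝ] ℝ) q :=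
    (hasFDerivAt_apply i q).sub_const _
  exact (hasDerivAt_divPow j a _).comp_hasFDerivAt q h

theorem pd_taylorDeriv (z : J5) (a b c : ℕ) (i : Fin 3) :
    pd i (taylorDeriv z a b c) = taylorDeriv z (a + if i = 0 then 1 else 0)
      (b + if i = 1 then 1 else 0) (c + if i = 2 then 1 else 0) := by
  ext q
  have h := HasFDerivAt.fun_sum (u := Finset.univ) fun (J : Idx) _ =>
    (((hasFDerivAt_divPow_coord (J.1 0) a 0 z.1 q).mul
      (hasFDerivAt_divPow_coord (J.1 1) b 1 z.1 q)).mul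
      (hasFDerivAt_divPow_coord (J.1 2) c 2 z.1 q)).const_mul (z.2 J)
  change fderiv ℝ (taylorDeriv z a b c) q (Pi.single i 1) = _
  have h' : HasFDerivAt (taylorDeriv z a b c) _ q := h
  rw [h'.fderiv]
  rw [sum_apply]
  refine Finset.sum_congr rfl fun J _ => ?_
  fin_cases i <;> simp [-mul_eq_mul_left_iff] <;> ring

theorem taylor_eq (z : J5) : taylor z = taylorDeriv z 0 0 0 := by
  ext q
  refine Finset.sum_congr rfl fun J _ => ?_
  simp [divPow, Fin.prod_univ_three, -Finset.prod_div_distrib]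

theorem pderiv_taylor (z : J5) (a b c : ℕ) : pderiv a b c (taylor z) = taylorDeriv z a b c := by
  have hc : ∀ c, (pd 2)^[c] (taylor z) = taylorDeriv z 0 0 c := by
    intro c
    induction c with
    | zero => exact taylor_eq z
    | succ c ih => rw [Function.iterate_succ_apply', ih, pd_taylorDeriv]; rfl
  have hb : ∀ b, (pd 1)^[b] (taylorDeriv z 0 0 c) = taylorDeriv z 0 b c := by
    intro b
    induction b with
    | zero => rfl
    | succ b ih => rw [Function.iterate_succ_apply', ih, pd_taylorDeriv]; rfl
  have ha : ∀ a, (pd 0)^[a] (taylorDeriv z 0 b c) = taylorDeriv z a b c := by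
    intro a
    induction a with
    | zero => rfl
    | succ a ih => rw [Function.iterate_succ_apply', ih, pd_taylorDeriv]; rfl
  rw [← ha, ← hb, ← hc]
  rfl

theorem contDiff_taylor (z : J5) : ContDiff ℝ ∞ (taylor z) := by
  unfold taylor
  fun_prop

/-- At the centre only the monomial with exponent exactly `J` survives `∂^J`. Hence `taylor z`
really represents the jet `z`. -/
theorem pdJ_taylor (z : J5) (J : Idx) : pdJ J (taylor z) z.1 = z.2 J := by
  rw [pdJ_eq, pderiv_taylor, taylorDeriv, Finset.sum_eq_single J]
  · simp [divPow_zero]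
  · intro K _ hK
    have : ¬ ((J.1 0 : ℕ) = K.1 0 ∧ (J.1 1 : ℕ) = K.1 1 ∧ (J.1 2 : ℕ) = K.1 2) := by
      rintro ⟨h0, h1, h2⟩
      refine hK (Subtype.ext (funext fun i => ?_))
      fin_cases i
      · exact Fin.ext h0.symm
      · exact Fin.ext h1.symm
      · exact Fin.ext h2.symm
    simp only [sub_self, divPow_zero]
    split_ifs <;> simp_all
  · simp

/-! ### Jets of compositions -/

section Comp

variable {E F G : Type*} [NormedAddCommGroup E] [NormedSpace ℝ E] [NormedAddCommGroup F]
  [NormedSpace ℝ F] [NormedAddCommGroup G] [NormedSpace ℝ G]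

/-- The Taylor series of a composition depends only on those of the factors. -/
theorem iteratedFDeriv_comp_congr {g₁ g₂ : F → G} {f₁ f₂ : E → F} {x : E} {n : ℕ}
    (hg₁ : ContDiffAt ℝ ∞ g₁ (f₁ x)) (hg₂ : ContDiffAt ℝ ∞ g₂ (f₂ x))
    (hf₁ : ContDiffAt ℝ ∞ f₁ x) (hf₂ : ContDiffAt ℝ ∞ f₂ x)
    (hg : ∀ k ≤ n, iteratedFDeriv ℝ k g₁ (f₁ x) = iteratedFDeriv ℝ k g₂ (f₂ x))
    (hf : ∀ k ≤ n, iteratedFDeriv ℝ k f₁ x = iteratedFDeriv ℝ k f₂ x) :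
    ∀ k ≤ n, iteratedFDeriv ℝ k (g₁ ∘ f₁) x = iteratedFDeriv ℝ k (g₂ ∘ f₂) x := by
  intro k hk
  -- By Faà di Bruno, order `k` involves only derivatives of the factors of order at most `k`: the
  -- number of blocks and the size of each block are bounded by `k`.
  rw [iteratedFDeriv_comp hg₁ hf₁ (by exact_mod_cast le_top),
    iteratedFDeriv_comp hg₂ hf₂ (by exact_mod_cast le_top)]
  refine Finset.sum_congr rfl fun c _ => ?_
  have h1 := hg _ (c.length_le.trans hk)
  have h2 : (fun m => iteratedFDeriv ℝ (c.partSize m) f₁ x) =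
      fun m => iteratedFDeriv ℝ (c.partSize m) f₂ x :=
    funext fun m => hf _ ((c.partSize_le m).trans hk)
  simp only [FormalMultilinearSeries.compAlongOrderedFinpartition, ftaylorSeries]
  rw [h1, h2]

end Comp

/-! ### Smoothness of the group action and jets of transformed sections -/

namespace OneParamGroup

variable {X : Set Base}

theorem contDiffAt_base (η : OneParamGroup X) (hX : IsOpen X) (s : ℝ) {p : Base} (hp : p ∈ X) :
    ContDiffAt ℝ ∞ (fun q : ℝ × Base => η.base q.1 q.2) (s, p) :=
  η.contDiffOn_base.contDiffAt ((isOpen_univ.prod hX).mem_nhds ⟨mem_univ _, hp⟩)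

theorem contDiffAt_fib (η : OneParamGroup X) (hX : IsOpen X) (s : ℝ) {p : Base} (hp : p ∈ X)
    (u : ℝ) : ContDiffAt ℝ ∞ (fun q : ℝ × Base × ℝ => η.fib q.1 q.2.1 q.2.2) (s, p, u) :=
  η.contDiffOn_fib.contDiffAt ((isOpen_univ.prod (hX.prod isOpen_univ)).mem_nhds
    ⟨mem_univ _, hp, mem_univ _⟩)

theorem base_neg_base (η : OneParamGroup X) (s : ℝ) {p : Base} (hp : p ∈ X) :
    η.base (-s) (η.base s p) = p := by
  rw [← η.base_add _ _ p hp, neg_add_cancel, η.base_zero p hp]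

/-- The action is jointly smooth. -/
theorem contDiffOn_act (η : OneParamGroup X) (hX : IsOpen X) {φ : Base → ℝ}
    (hφ : ContDiffOn ℝ ∞ φ X) :
    ContDiffOn ℝ ∞ (fun q : ℝ × Base => η.act q.1 φ q.2) (univ ×ˢ X) := by
  rintro ⟨s, p⟩ ⟨-, hp⟩
  refine ContDiffAt.contDiffWithinAt ?_
  have hm : η.base (-s) p ∈ X := η.mapsTo _ hp
  have hb : ContDiffAt ℝ ∞ (fun q : ℝ × Base => η.base (-q.1) q.2) (s, p) :=
    ContDiffAt.comp (s, p) (g := fun q : ℝ × Base => η.base q.1 q.2)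
      (f := fun q : ℝ × Base => (-q.1, q.2)) (η.contDiffAt_base hX (-s) hp) (by fun_prop)
  have hφb : ContDiffAt ℝ ∞ (fun q : ℝ × Base => φ (η.base (-q.1) q.2)) (s, p) :=
    ContDiffAt.comp (s, p) (g := φ) (hφ.contDiffAt (hX.mem_nhds hm)) hb
  exact ContDiffAt.comp (s, p) (g := fun q : ℝ × Base × ℝ => η.fib q.1 q.2.1 q.2.2)
    (f := fun q : ℝ × Base => (q.1, η.base (-q.1) q.2, φ (η.base (-q.1) q.2)))
    (η.contDiffAt_fib hX s hm _) (contDiffAt_fst.prodMk (hb.prodMk hφb))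

theorem contDiffOn_act_right (η : OneParamGroup X) (hX : IsOpen X) {φ : Base → ℝ}
    (hφ : ContDiffOn ℝ ∞ φ X) (s : ℝ) : ContDiffOn ℝ ∞ (η.act s φ) X :=
  (η.contDiffOn_act hX hφ).comp (f := fun p : Base => (s, p)) (by fun_prop)
    fun _ hp => ⟨mem_univ _, hp⟩

/-- The prolonged group maps jets of sections to jets of transformed sections. -/
theorem prolong_jet (η : OneParamGroup X) (hX : IsOpen X) {φ : Base → ℝ}
    (hφ : ContDiffOn ℝ ∞ φ X) (s : ℝ) {p : Base} (hp : p ∈ X) :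
    η.prolong s (jet φ p) = jet (η.act s φ) (η.base s p) := by
  set ψ := taylor (jet φ p) with hψ_def
  have hψ : ContDiffOn ℝ ∞ ψ X := (contDiff_taylor _).contDiffOn
  have hp' : η.base s p ∈ X := η.mapsTo s hp
  have hbp := η.base_neg_base s hp
  have hJ : ∀ a b c, a + b + c ≤ 5 → pderiv a b c ψ p = pderiv a b c φ p := by
    intro a b c h
    have := pdJ_taylor (jet φ p) ⟨![⟨a, by omega⟩, ⟨b, by omega⟩, ⟨c, by omega⟩],
      by simpa [Fin.sum_univ_three] using h⟩
    exact this
  have h0 := iteratedFDeriv_eq_of_pderiv_eq hX hp 5 hψ hφ hJ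
  have hψp : ContDiffAt ℝ ∞ ψ p := hψ.contDiffAt (hX.mem_nhds hp)
  have hφp : ContDiffAt ℝ ∞ φ p := hφ.contDiffAt (hX.mem_nhds hp)
  have h1 : ∀ k ≤ 5, iteratedFDeriv ℝ k (fun r => (r, ψ r)) p =
      iteratedFDeriv ℝ k (fun r => (r, φ r)) p := by
    intro k hk
    rw [iteratedFDeriv_prodMk contDiffAt_fun_id hψp (by exact_mod_cast le_top),
      iteratedFDeriv_prodMk contDiffAt_fun_id hφp (by exact_mod_cast le_top), h0 k hk]
  have hval : ψ p = φ p := by simpa using! hJ 0 0 0 (by norm_num)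
  have hfib : ContDiffAt ℝ ∞ (fun q : Base × ℝ => η.fib s q.1 q.2) (p, φ p) :=
    ContDiffAt.comp (p, φ p) (g := fun q : ℝ × Base × ℝ => η.fib q.1 q.2.1 q.2.2)
      (f := fun q : Base × ℝ => (s, q.1, q.2)) (η.contDiffAt_fib hX s hp _) (by fun_prop)
  -- The transformed section is `fib s` after the graph map after `base (-s)`. Agreement to order 5
  -- of `ψ` and `φ` at `p` passes first through the outer composition, then through the change of
  -- base point.
  have h2 := iteratedFDeriv_comp_congr (n := 5) (g₁ := fun q : Base × ℝ => η.fib s q.1 q.2)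
    (g₂ := fun q : Base × ℝ => η.fib s q.1 q.2) (f₁ := fun r => (r, ψ r))
    (f₂ := fun r => (r, φ r)) (x := p) (by rw [hval]; exact hfib) hfib
    (contDiffAt_fun_id.prodMk hψp) (contDiffAt_fun_id.prodMk hφp)
    (fun k _ => by rw [hval]) h1
  have hb : ContDiffAt ℝ ∞ (η.base (-s)) (η.base s p) :=
    ContDiffAt.comp (η.base s p) (g := fun q : ℝ × Base => η.base q.1 q.2)
      (f := fun q : Base => (-s, q)) (η.contDiffAt_base hX (-s) hp') (by fun_prop)
  have h3 := iteratedFDeriv_comp_congr (n := 5)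
    (g₁ := (fun q : Base × ℝ => η.fib s q.1 q.2) ∘ fun r => (r, ψ r))
    (g₂ := (fun q : Base × ℝ => η.fib s q.1 q.2) ∘ fun r => (r, φ r))
    (f₁ := η.base (-s)) (f₂ := η.base (-s)) (x := η.base s p)
    (by rw [hbp]; exact ContDiffAt.comp p (by rw [hval]; exact hfib) (contDiffAt_fun_id.prodMk hψp))
    (by rw [hbp]; exact ContDiffAt.comp p hfib (contDiffAt_fun_id.prodMk hφp)) hb hb
    (by rw [hbp]; exact h2) (fun _ _ => rfl)
  have h4 := pderiv_eq_of_iteratedFDeriv_eq hX hp' 5 (η.contDiffOn_act_right hX hψ s)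
    (η.contDiffOn_act_right hX hφ s) h3
  refine Prod.ext rfl (funext fun J => ?_)
  exact h4 _ _ _ (by simpa [Fin.sum_univ_three] using J.2)

end OneParamGroup

end Prolongation

section Generator

/-! ### The generator of the prolonged group -/

section Param

variable {X : Set Base} {Ψ : ℝ × Base → ℝ}

/-- The partial derivative `∂ₓᵃ ∂ᵧᵇ ∂ₜᶜ` of a function of `(s, p)` with respect to `p`. -/
def paramDeriv (a b c : ℕ) (Ψ : ℝ × Base → ℝ) : ℝ × Base → ℝ :=
  mixedDeriv (0, Pi.single 0 1) (0, Pi.single 1 1) (0, Pi.single 2 1) a b c Ψ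

theorem fderiv_slice (hX : IsOpen X) (hΨ : ContDiffOn ℝ ∞ Ψ (univ ×ˢ X)) (s : ℝ) {p : Base}
    (hp : p ∈ X) (v : Base) : fderiv ℝ (fun q => Ψ (s, q)) p v = fderiv ℝ Ψ (s, p) (0, v) := by
  have hd : DifferentiableAt ℝ Ψ (s, p) :=
    (hΨ.contDiffAt ((isOpen_univ.prod hX).mem_nhds ⟨mem_univ _, hp⟩)).differentiableAt (by simp)
  have h := hd.hasFDerivAt.comp p (hasFDerivAt_prodMk_right s p)
  have h' : HasFDerivAt (fun q => Ψ (s, q)) _ p := h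
  rw [h'.fderiv]
  simp

theorem iterate_pd_slice (hX : IsOpen X) (hΨ : ContDiffOn ℝ ∞ Ψ (univ ×ˢ X)) (s : ℝ) (i : Fin 3)
    {f : Base → ℝ} (hf : EqOn f (fun q => Ψ (s, q)) X) (n : ℕ) :
    EqOn ((pd i)^[n] f) (fun q => (dirDeriv (0, Pi.single i 1))^[n] Ψ (s, q)) X := by
  induction n with
  | zero => exact hf
  | succ n ih =>
    rw [Function.iterate_succ_apply', Function.iterate_succ_apply']
    refine (eqOn_dirDeriv hX ih _).trans fun q hq => ?_
    exact fderiv_slice hX (contDiffOn_iterate_dirDeriv (isOpen_univ.prod hX) hΨ _ n) s hq _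

/-- In the joint space, spatial derivatives are taken along the vectors `(0, eᵢ)` and the parameter
is one more direction. Exchanging `d/ds` with `∂^J` thus becomes symmetry of mixed derivatives. -/
theorem pderiv_slice (hX : IsOpen X) (hΨ : ContDiffOn ℝ ∞ Ψ (univ ×ˢ X)) (s : ℝ) (a b c : ℕ)
    {f : Base → ℝ} (hf : EqOn f (fun q => Ψ (s, q)) X) :
    EqOn (pderiv a b c f) (fun q => paramDeriv a b c Ψ (s, q)) X := by
  have hO := isOpen_univ (X := ℝ) |>.prod hX
  have hc := contDiffOn_iterate_dirDeriv hO hΨ (0, Pi.single 2 1) c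
  have hb := contDiffOn_iterate_dirDeriv hO hc (0, Pi.single 1 1) b
  exact iterate_pd_slice hX hb s 0 (iterate_pd_slice hX hc s 1 (iterate_pd_slice hX hΨ s 2 hf c) b) a

theorem contDiffOn_paramDeriv (hX : IsOpen X) (hΨ : ContDiffOn ℝ ∞ Ψ (univ ×ˢ X)) (a b c : ℕ) :
    ContDiffOn ℝ ∞ (paramDeriv a b c Ψ) (univ ×ˢ X) :=
  contDiffOn_mixedDeriv _ _ _ a b c (isOpen_univ.prod hX) hΨ

theorem differentiableAt_paramDeriv (hX : IsOpen X) (hΨ : ContDiffOn ℝ ∞ Ψ (univ ×ˢ X))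
    (a b c : ℕ) (s : ℝ) {p : Base} (hp : p ∈ X) :
    DifferentiableAt ℝ (paramDeriv a b c Ψ) (s, p) :=
  ((contDiffOn_paramDeriv hX hΨ a b c).contDiffAt
    ((isOpen_univ.prod hX).mem_nhds ⟨mem_univ _, hp⟩)).differentiableAt (by simp)

/-- Differentiation in the parameter commutes with partial derivatives. -/
theorem fderiv_paramDeriv (hX : IsOpen X) (hΨ : ContDiffOn ℝ ∞ Ψ (univ ×ˢ X)) (a b c : ℕ)
    (s : ℝ) {p : Base} (hp : p ∈ X) :
    fderiv ℝ (paramDeriv a b c Ψ) (s, p) (1, 0) =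
      pderiv a b c (fun q => dirDeriv (1, 0) Ψ (s, q)) p := by
  have hO := isOpen_univ (X := ℝ) |>.prod hX
  rw [pderiv_slice hX (contDiffOn_dirDeriv hO hΨ (1, 0)) s a b c (fun _ _ => rfl) hp]
  exact dirDeriv_mixedDeriv _ _ _ a b c hO hΨ (1, 0) ⟨mem_univ _, hp⟩

theorem fderiv_jet {φ : Base → ℝ} (hX : IsOpen X) (hφ : ContDiffOn ℝ ∞ φ X) {p : Base}
    (hp : p ∈ X) (v : Base) :
    fderiv ℝ (jet φ) p v = (v, fun J => fderiv ℝ (pdJ J φ) p v) := by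
  have hJ : ∀ J : Idx, DifferentiableAt ℝ (pdJ J φ) p := fun J =>
    ((contDiffOn_pderiv hX hφ _ _ _).contDiffAt (hX.mem_nhds hp)).differentiableAt (by simp)
  have h : HasFDerivAt (jet φ) ((ContinuousLinearMap.id ℝ Base).prod
      (ContinuousLinearMap.pi fun J => fderiv ℝ (pdJ J φ) p)) p :=
    (hasFDerivAt_id p).prodMk (hasFDerivAt_pi.2 fun J => (hJ J).hasFDerivAt)
  rw [h.fderiv]
  rfl

end Param

namespace OneParamGroup

variable {X : Set Base}

/-- The infinitesimal variation `d/ds (η_Y^s ∘ φ ∘ (η_X^s)⁻¹)` at `s = 0`. -/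
def variation (η : OneParamGroup X) (φ : Base → ℝ) (p : Base) : ℝ :=
  dirDeriv ((1, 0) : ℝ × Base) (fun q : ℝ × Base => η.act q.1 φ q.2) (0, p)

/-- The generator of the group on the base. -/
def baseGenerator (η : OneParamGroup X) (p : Base) : Base := deriv (fun s => η.base s p) 0

theorem act_zero (η : OneParamGroup X) (φ : Base → ℝ) {p : Base} (hp : p ∈ X) :
    η.act 0 φ p = φ p := by
  simp [act, η.base_zero p hp, η.fib_zero p hp]

theorem contDiffOn_variation (η : OneParamGroup X) (hX : IsOpen X) {φ : Base → ℝ}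
    (hφ : ContDiffOn ℝ ∞ φ X) : ContDiffOn ℝ ∞ (η.variation φ) X :=
  (contDiffOn_dirDeriv (isOpen_univ.prod hX) (η.contDiffOn_act hX hφ) (1, 0)).comp
    (f := fun p : Base => ((0 : ℝ), p)) (by fun_prop) fun _ hp => ⟨mem_univ _, hp⟩

theorem hasDerivAt_pderiv_act (η : OneParamGroup X) (hX : IsOpen X) {φ : Base → ℝ}
    (hφ : ContDiffOn ℝ ∞ φ X) {p : Base} (hp : p ∈ X) (a b c : ℕ) :
    HasDerivAt (fun s => pderiv a b c (η.act s φ) p) (pderiv a b c (η.variation φ) p) 0 := by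
  have hΨ := η.contDiffOn_act hX hφ
  have h1 : (fun s => pderiv a b c (η.act s φ) p) =
      fun s => paramDeriv a b c (fun q : ℝ × Base => η.act q.1 φ q.2) (s, p) := by
    ext s
    exact pderiv_slice hX hΨ s a b c (fun _ _ => rfl) hp
  have h2 : pderiv a b c (η.variation φ) p = _ := (fderiv_paramDeriv hX hΨ a b c 0 hp).symm
  rw [h1, h2]
  have hs : HasDerivAt (fun s : ℝ => (s, p)) ((1 : ℝ), (0 : Base)) 0 :=
    (hasDerivAt_id (0 : ℝ)).prodMk (hasDerivAt_const _ _)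
  exact (differentiableAt_paramDeriv hX hΨ a b c 0 hp).hasFDerivAt.comp_hasDerivAt (0 : ℝ) hs

/-- On the jet of a section the prolonged generator is the sum of a vector tangent to the
jet and the jet of the variation. -/
theorem jetGenerator_jet (η : OneParamGroup X) (hX : IsOpen X) {φ : Base → ℝ}
    (hφ : ContDiffOn ℝ ∞ φ X) {p : Base} (hp : p ∈ X) :
    η.jetGenerator (jet φ p) =
      fderiv ℝ (jet φ) p (η.baseGenerator p) + (0, fun J => pdJ J (η.variation φ) p) := by
  have hΨ := η.contDiffOn_act hX hφ
  set Ψ : ℝ × Base → ℝ := fun q => η.act q.1 φ q.2 with hΨ_def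
  have hb : HasDerivAt (fun s => η.base s p) (η.baseGenerator p) 0 := by
    have h := ((η.contDiffAt_base hX 0 hp).differentiableAt (by simp)).comp (0 : ℝ)
      (f := fun s : ℝ => (s, p)) (by fun_prop)
    exact DifferentiableAt.hasDerivAt h
  have hsb : HasDerivAt (fun s => (s, η.base s p)) ((1 : ℝ), η.baseGenerator p) 0 :=
    (hasDerivAt_id (0 : ℝ)).prodMk hb
  have hcomp : ∀ J : Idx, HasDerivAt (fun s => pdJ J (η.act s φ) (η.base s p))
      (fderiv ℝ (pdJ J φ) p (η.baseGenerator p) + pdJ J (η.variation φ) p) 0 := by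
    intro J
    set a : ℕ := ↑(J.1 0)
    set b : ℕ := ↑(J.1 1)
    set c : ℕ := ↑(J.1 2)
    -- Both dependences on `s` sit in one function of `(s, p)`. Its velocity `(1, baseGenerator p)`
    -- at `s = 0` splits into `(1, 0)`, giving the variation, and `(0, baseGenerator p)`, giving the
    -- derivative along the jet since the action at `s = 0` is trivial.
    have h1 : (fun s => pdJ J (η.act s φ) (η.base s p)) =
        fun s => paramDeriv a b c Ψ (s, η.base s p) := by
      ext s
      exact pderiv_slice hX hΨ s a b c (fun _ _ => rfl) (η.mapsTo s hp)
    have h2 : fderiv ℝ (pdJ J φ) p (η.baseGenerator p) =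
        fderiv ℝ (paramDeriv a b c Ψ) (0, p) (0, η.baseGenerator p) := by
      rw [← fderiv_slice hX (contDiffOn_paramDeriv hX hΨ a b c) 0 hp]
      exact eqOn_dirDeriv hX (pderiv_slice hX hΨ 0 a b c
        (fun q hq => (η.act_zero φ hq).symm)) _ hp
    have h3 : pdJ J (η.variation φ) p = fderiv ℝ (paramDeriv a b c Ψ) (0, p) (1, 0) :=
      (fderiv_paramDeriv hX hΨ a b c 0 hp).symm
    rw [h1, h2, h3, ← map_add, Prod.mk_add_mk, zero_add, add_zero]
    have hd := (differentiableAt_paramDeriv hX hΨ a b c 0 hp).hasFDerivAt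
    refine HasFDerivAt.comp_hasDerivAt (0 : ℝ) ?_ hsb
    rwa [η.base_zero p hp]
  have hpro : (fun s => η.prolong s (jet φ p)) =
      fun s => (η.base s p, fun J => pdJ J (η.act s φ) (η.base s p)) := by
    ext1 s
    exact η.prolong_jet hX hφ s hp
  rw [jetGenerator, hpro, fderiv_jet hX hφ hp]
  rw [(hb.prodMk (hasDerivAt_pi.2 hcomp)).deriv]
  ext <;> simp

end OneParamGroup

end Generator

section CartanForm

/-! ### The exterior derivative of the Cartan form -/

theorem wedge3_apply (a b c : J5 →L[ℝ] ℝ) (v : Fin 3 → J5) :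
    wedge3 a b c v = a (v 0) * b (v 1) * c (v 2) - a (v 0) * b (v 2) * c (v 1)
      - a (v 1) * b (v 0) * c (v 2) + a (v 1) * b (v 2) * c (v 0)
      + a (v 2) * b (v 0) * c (v 1) - a (v 2) * b (v 1) * c (v 0) := by
  have h : wedge3 a b c v = (Matrix.of fun j i => (![a, b, c] i) (v j)).det := by
    rw [wedge3, ContinuousMultilinearMap.alternatization_apply_apply, Matrix.det_apply]
    refine Finset.sum_congr rfl fun s _ => ?_
    simp
  rw [h, Matrix.det_fin_three]
  simp
  ring

/-- The value of `a ∧ τ` for a covector `a` and a `3`-form `τ`. -/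
def wedgeApply (a : J5 →L[ℝ] ℝ) (τ : J5 [⋀^Fin 3]→L[ℝ] ℝ) (v : Fin 4 → J5) : ℝ :=
  ∑ i : Fin 4, (-1 : ℝ) ^ (i : ℕ) * (a (v i) * τ (i.removeNth v))

theorem wedgeApply_eq (a : J5 →L[ℝ] ℝ) (τ : J5 [⋀^Fin 3]→L[ℝ] ℝ) (v₀ v₁ v₂ v₃ : J5) :
    wedgeApply a τ ![v₀, v₁, v₂, v₃] = a v₀ * τ ![v₁, v₂, v₃] - a v₁ * τ ![v₀, v₂, v₃]
      + a v₂ * τ ![v₀, v₁, v₃] - a v₃ * τ ![v₀, v₁, v₂] := by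
  have h0 : Fin.removeNth 0 ![v₀, v₁, v₂, v₃] = ![v₁, v₂, v₃] := by
    funext k; fin_cases k <;> rfl
  have h1 : Fin.removeNth 1 ![v₀, v₁, v₂, v₃] = ![v₀, v₂, v₃] := by
    funext k; fin_cases k <;> rfl
  have h2 : Fin.removeNth 2 ![v₀, v₁, v₂, v₃] = ![v₀, v₁, v₃] := by
    funext k; fin_cases k <;> rfl
  have h3 : Fin.removeNth 3 ![v₀, v₁, v₂, v₃] = ![v₀, v₁, v₂] := by
    funext k; fin_cases k <;> rfl
  rw [wedgeApply, Fin.sum_univ_four, h0, h1, h2, h3]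
  simp
  ring

/-- The base covectors annihilate `w` and `v`, so `a` and `b` must absorb both of them. -/
theorem wedgeApply_vertical (a b : J5 →L[ℝ] ℝ) (i j : Fin 3) {w v : J5} (hw : w.1 = 0)
    (hv : v.1 = 0) (m₀ m₁ : J5) :
    wedgeApply a (wedge3 b (dX i) (dX j)) ![w, v, m₀, m₁] =
      (a w * b v - a v * b w) * (m₀.1 i * m₁.1 j - m₀.1 j * m₁.1 i) := by
  have hwX : ∀ k, dX k w = 0 := fun k => by simp [dX, hw]
  have hvX : ∀ k, dX k v = 0 := fun k => by simp [dX, hv]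
  have hm : ∀ k (m : J5), dX k m = m.1 k := fun _ _ => rfl
  rw [wedgeApply_eq]
  simp [wedge3_apply, hwX, hvX, hm]
  ring

/-- Only `b` can absorb `w`; moving `w` past the slot of `a` produces the sign. -/
theorem wedgeApply_tangent (a b : J5 →L[ℝ] ℝ) (i j : Fin 3) {w : J5} (hw : w.1 = 0)
    (haw : a w = 0) (T₀ T₁ T₂ : J5) :
    wedgeApply a (wedge3 b (dX i) (dX j)) ![w, T₀, T₁, T₂] =
      -b w * (a T₀ * (T₁.1 i * T₂.1 j - T₁.1 j * T₂.1 i) - a T₁ * (T₀.1 i * T₂.1 j - T₀.1 j * T₂.1 i)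
        + a T₂ * (T₀.1 i * T₁.1 j - T₀.1 j * T₁.1 i)) := by
  have hwX : ∀ k, dX k w = 0 := fun k => by simp [dX, hw]
  have hm : ∀ k (m : J5), dX k m = m.1 k := fun _ _ => rfl
  rw [wedgeApply_eq]
  simp [wedge3_apply, hwX, haw, hm]
  ring

/-- The differential of the coefficient of `dx ∧ dy ∧ dt` in the Cartan form. -/
def dCoeffVol (σ : ℝ) (z : J5) : J5 →L[ℝ] ℝ :=
  fderiv ℝ (fun z : J5 => 1 / 2 * z.2 (mi 3 0 0) ^ 2 - σ / 2 * z.2 (mi 1 1 0) ^ 2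
    + 2 * z.2 (mi 1 0 0) * z.2 (mi 2 0 1) + 6 * z.2 (mi 1 0 0) * z.2 (mi 2 0 0) * z.2 (mi 3 0 0)
    + σ * z.2 (mi 1 0 0) * z.2 (mi 1 2 0) + z.2 (mi 1 0 0) * z.2 (mi 5 0 0)
    - z.2 (mi 2 0 0) * z.2 (mi 1 0 1) - 2 * z.2 (mi 2 0 0) ^ 3
    - z.2 (mi 2 0 0) * z.2 (mi 4 0 0)) z

/-- The differential of the coefficient of `dφ ∧ dy ∧ dt` in the Cartan form. -/
def dCoeffPhi (σ : ℝ) (z : J5) : J5 →L[ℝ] ℝ :=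
  (-2 : ℝ) • dPhi (mi 2 0 1) - (6 : ℝ) • (z.2 (mi 2 0 0) • dPhi (mi 3 0 0)
    + z.2 (mi 3 0 0) • dPhi (mi 2 0 0)) - σ • dPhi (mi 1 2 0) - dPhi (mi 5 0 0)

/-- The differential of the coefficient of `dφ_x ∧ dy ∧ dt` in the Cartan form. -/
def dCoeffPhiX (z : J5) : J5 →L[ℝ] ℝ :=
  dPhi (mi 1 0 1) + (6 * z.2 (mi 2 0 0)) • dPhi (mi 2 0 0) + dPhi (mi 4 0 0)

theorem hasFDerivAt_coord (J : Idx) (z : J5) : HasFDerivAt (fun z : J5 => z.2 J) (dPhi J) z :=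
  (dPhi J).hasFDerivAt

theorem hasFDerivAt_theta (σ : ℝ) (z : J5) :
    HasFDerivAt (theta σ)
      ((dCoeffVol σ z).smulRight (wedge3 (dX 0) (dX 1) (dX 2))
        + (dCoeffPhi σ z).smulRight (wedge3 (dPhi (mi 0 0 0)) (dX 1) (dX 2))
        + (dCoeffPhiX z).smulRight (wedge3 (dPhi (mi 1 0 0)) (dX 1) (dX 2))
        - (dPhi (mi 3 0 0)).smulRight (wedge3 (dPhi (mi 2 0 0)) (dX 1) (dX 2))
        - (σ • dPhi (mi 1 1 0)).smulRight (wedge3 (dPhi (mi 1 0 0)) (dX 0) (dX 2))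
        + (dPhi (mi 2 0 0)).smulRight (wedge3 (dPhi (mi 1 0 0)) (dX 0) (dX 1))) z := by
  have h0 : HasFDerivAt _ (dCoeffVol σ z) z := DifferentiableAt.hasFDerivAt (by fun_prop)
  have h1 : HasFDerivAt (fun z : J5 => -2 * z.2 (mi 2 0 1) - 6 * z.2 (mi 2 0 0) * z.2 (mi 3 0 0)
      - σ * z.2 (mi 1 2 0) - z.2 (mi 5 0 0)) (dCoeffPhi σ z) z := by
    refine (((((hasFDerivAt_coord (mi 2 0 1) z).const_mul (-2)).sub
      (((hasFDerivAt_coord (mi 2 0 0) z).const_mul 6).mul (hasFDerivAt_coord (mi 3 0 0) z))).sub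
      ((hasFDerivAt_coord (mi 1 2 0) z).const_mul σ)).sub (hasFDerivAt_coord (mi 5 0 0) z)).congr_fderiv ?_
    simp only [dCoeffPhi]
    module
  have h2 : HasFDerivAt (fun z : J5 => z.2 (mi 1 0 1) + 3 * z.2 (mi 2 0 0) ^ 2 + z.2 (mi 4 0 0))
      (dCoeffPhiX z) z := by
    refine (((hasFDerivAt_coord (mi 1 0 1) z).add
      (((hasFDerivAt_coord (mi 2 0 0) z).pow 2).const_mul 3)).add
      (hasFDerivAt_coord (mi 4 0 0) z)).congr_fderiv ?_
    simp only [dCoeffPhiX]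
    module
  exact (((((h0.smul_const (wedge3 (dX 0) (dX 1) (dX 2))).add
    (h1.smul_const (wedge3 (dPhi (mi 0 0 0)) (dX 1) (dX 2)))).add
    (h2.smul_const (wedge3 (dPhi (mi 1 0 0)) (dX 1) (dX 2)))).sub
    ((hasFDerivAt_coord (mi 3 0 0) z).smul_const (wedge3 (dPhi (mi 2 0 0)) (dX 1) (dX 2)))).sub
    (((hasFDerivAt_coord (mi 1 1 0) z).const_mul σ).smul_const
      (wedge3 (dPhi (mi 1 0 0)) (dX 0) (dX 2)))).add
    ((hasFDerivAt_coord (mi 2 0 0) z).smul_const (wedge3 (dPhi (mi 1 0 0)) (dX 0) (dX 1)))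

theorem Omega_apply (σ : ℝ) (z : J5) (v : Fin 4 → J5) :
    Omega σ z v =
      -(wedgeApply (dCoeffVol σ z) (wedge3 (dX 0) (dX 1) (dX 2)) v
        + wedgeApply (dCoeffPhi σ z) (wedge3 (dPhi (mi 0 0 0)) (dX 1) (dX 2)) v
        + wedgeApply (dCoeffPhiX z) (wedge3 (dPhi (mi 1 0 0)) (dX 1) (dX 2)) v
        - wedgeApply (dPhi (mi 3 0 0)) (wedge3 (dPhi (mi 2 0 0)) (dX 1) (dX 2)) v
        - wedgeApply (σ • dPhi (mi 1 1 0)) (wedge3 (dPhi (mi 1 0 0)) (dX 0) (dX 2)) v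
        + wedgeApply (dPhi (mi 2 0 0)) (wedge3 (dPhi (mi 1 0 0)) (dX 0) (dX 1)) v) := by
  rw [Omega, ContinuousAlternatingMap.neg_apply, extDeriv, (hasFDerivAt_theta σ z).fderiv,
    ContinuousAlternatingMap.alternatizeUncurryFin_apply]
  simp only [wedgeApply, ← Finset.sum_add_distrib, ← Finset.sum_sub_distrib]
  congr 1
  refine Finset.sum_congr rfl fun i _ => ?_
  simp
  ring

/-- The multisymplectic form on two vertical vectors. -/
theorem Omega_vertical (σ : ℝ) (z w v m₀ m₁ : J5) (hw : w.1 = 0) (hv : v.1 = 0) :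
    Omega σ z ![w, v, m₀, m₁] =
      -((dCoeffPhi σ z w * v.2 (mi 0 0 0) - dCoeffPhi σ z v * w.2 (mi 0 0 0)
          + (dCoeffPhiX z w * v.2 (mi 1 0 0) - dCoeffPhiX z v * w.2 (mi 1 0 0))
          - (w.2 (mi 3 0 0) * v.2 (mi 2 0 0) - v.2 (mi 3 0 0) * w.2 (mi 2 0 0)))
          * (m₀.1 1 * m₁.1 2 - m₀.1 2 * m₁.1 1)
        - σ * (w.2 (mi 1 1 0) * v.2 (mi 1 0 0) - v.2 (mi 1 1 0) * w.2 (mi 1 0 0))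
          * (m₀.1 0 * m₁.1 2 - m₀.1 2 * m₁.1 0)
        + (w.2 (mi 2 0 0) * v.2 (mi 1 0 0) - v.2 (mi 2 0 0) * w.2 (mi 1 0 0))
          * (m₀.1 0 * m₁.1 1 - m₀.1 1 * m₁.1 0)) := by
  rw [Omega_apply]
  simp only [wedgeApply_vertical _ _ _ _ hw hv]
  have hX : ∀ k (m : J5), dX k m = m.1 k := fun _ _ => rfl
  have hP : ∀ J (m : J5), dPhi J m = m.2 J := fun _ _ => rfl
  simp only [hX, hP, hw, hv, Pi.zero_apply, FunLike.coe_smul, Pi.smul_apply, smul_eq_mul]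
  ring

/-- The coefficient contains no undifferentiated `φ`. -/
theorem dCoeffVol_single (σ : ℝ) (z : J5) :
    dCoeffVol σ z (0, Pi.single (mi 0 0 0) 1) = 0 := by
  have hd : DifferentiableAt ℝ (fun z : J5 => 1 / 2 * z.2 (mi 3 0 0) ^ 2 - σ / 2 * z.2 (mi 1 1 0) ^ 2
    + 2 * z.2 (mi 1 0 0) * z.2 (mi 2 0 1) + 6 * z.2 (mi 1 0 0) * z.2 (mi 2 0 0) * z.2 (mi 3 0 0)
    + σ * z.2 (mi 1 0 0) * z.2 (mi 1 2 0) + z.2 (mi 1 0 0) * z.2 (mi 5 0 0)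
    - z.2 (mi 2 0 0) * z.2 (mi 1 0 1) - 2 * z.2 (mi 2 0 0) ^ 3
    - z.2 (mi 2 0 0) * z.2 (mi 4 0 0)) z := by fun_prop
  rw [dCoeffVol, ← hd.lineDeriv_eq_fderiv, lineDeriv]
  have hne : ∀ J : Idx, J ≠ mi 0 0 0 → ∀ t : ℝ,
      (z + t • ((0, Pi.single (mi 0 0 0) 1) : J5)).2 J = z.2 J := by
    intro J hJ t
    simp [Pi.single_eq_of_ne hJ]
  simp only [hne (mi 3 0 0) (by decide), hne (mi 1 1 0) (by decide), hne (mi 1 0 0) (by decide),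
    hne (mi 2 0 1) (by decide), hne (mi 2 0 0) (by decide), hne (mi 1 2 0) (by decide),
    hne (mi 5 0 0) (by decide), hne (mi 1 0 1) (by decide), hne (mi 4 0 0) (by decide),
    deriv_const]

end CartanForm

section Conservation

variable {σ : ℝ} {X : Set Base} {φ : Base → ℝ}

/-! ### The Euler–Lagrange equation and its linearization -/

/-- Constant vector fields already realize every vector at a given point. -/
theorem IsSolution.Omega_eq_zero (hφ : IsSolution σ X φ) {p : Base} (hp : p ∈ X) (w : J5)
    (m₀ m₁ m₂ : Base) :
    Omega σ (jet φ p) ![w, fderiv ℝ (jet φ) p m₀, fderiv ℝ (jet φ) p m₁, fderiv ℝ (jet φ) p m₂]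
      = 0 := by
  have h := hφ.2 (fun _ => w) contDiffOn_const p hp
  have h' := congrArg (fun A => A ![m₀, m₁, m₂]) h
  simp only [pullback, contract, ContinuousAlternatingMap.compContinuousLinearMap_apply,
    ContinuousAlternatingMap.curryLeft_apply_apply] at h'
  refine Eq.trans ?_ h'
  congr 1
  funext k
  fin_cases k <;> rfl

/-- A solution satisfies the KP equation in potential form. -/
theorem IsSolution.kp (hX : IsOpen X) (hφ : IsSolution σ X φ) {p : Base} (hp : p ∈ X) :
    2 * pderiv 3 0 1 φ p + 6 * pderiv 2 0 0 φ p * pderiv 4 0 0 φ p + 6 * pderiv 3 0 0 φ p ^ 2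
      + pderiv 6 0 0 φ p + σ * pderiv 2 2 0 φ p = 0 := by
  -- The test vector `∂/∂φ` is annihilated by every covector in `dθ` except `dφ`. Only the `dφ ∧ dy
  -- ∧ dt` term is left, and it yields the `x`-derivative of its coefficient along the section.
  set w : J5 := (0, Pi.single (mi 0 0 0) 1) with hw_def
  have hP : ∀ J (m : J5), dPhi J m = m.2 J := fun _ _ => rfl
  have hwJ : ∀ J : Idx, J ≠ mi 0 0 0 → w.2 J = 0 := fun J hJ => Pi.single_eq_of_ne hJ _
  have hw0 : w.2 (mi 0 0 0) = 1 := by simp [hw_def]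
  have h1 : dCoeffPhi σ (jet φ p) w = 0 := by
    simp [dCoeffPhi, hP, hwJ (mi 2 0 1) (by decide), hwJ (mi 3 0 0) (by decide),
      hwJ (mi 2 0 0) (by decide), hwJ (mi 1 2 0) (by decide), hwJ (mi 5 0 0) (by decide)]
  have h2 : dCoeffPhiX (jet φ p) w = 0 := by
    simp [dCoeffPhiX, hP, hwJ (mi 1 0 1) (by decide), hwJ (mi 2 0 0) (by decide),
      hwJ (mi 4 0 0) (by decide)]
  have h3 : dPhi (mi 3 0 0) w = 0 := hwJ (mi 3 0 0) (by decide)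
  have h4 : (σ • dPhi (mi 1 1 0)) w = 0 := by simp [hP, hwJ (mi 1 1 0) (by decide)]
  have h5 : dPhi (mi 2 0 0) w = 0 := hwJ (mi 2 0 0) (by decide)
  have h := hφ.Omega_eq_zero hp w (Pi.single 0 1) (Pi.single 1 1) (Pi.single 2 1)
  rw [Omega_apply, wedgeApply_tangent _ _ _ _ rfl (dCoeffVol_single σ _),
    wedgeApply_tangent _ _ _ _ rfl h1, wedgeApply_tangent _ _ _ _ rfl h2,
    wedgeApply_tangent _ _ _ _ rfl h3, wedgeApply_tangent _ _ _ _ rfl h4,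
    wedgeApply_tangent _ _ _ _ rfl h5] at h
  have hX0 : dX 0 w = 0 := rfl
  have hPx : dPhi (mi 1 0 0) w = 0 := hwJ (mi 1 0 0) (by decide)
  have hP0 : dPhi (mi 0 0 0) w = 1 := hw0
  rw [hX0, hPx, hP0, h5] at h
  simp only [fderiv_jet hX hφ.1 hp] at h
  simp [dCoeffPhi, hP] at h
  -- Only `x`-derivatives were added, and `pderiv` applies those outermost, so raising the order in
  -- `x` is definitional.
  change -(2 * pderiv 3 0 1 φ p) - (6 * (pderiv 2 0 0 φ p * pderiv 4 0 0 φ p)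
    + 6 * (pderiv 3 0 0 φ p * pderiv 3 0 0 φ p)) - σ * pderiv 2 2 0 φ p - pderiv 6 0 0 φ p = 0 at h
  linarith

/-- The linearization of the KP equation at `φ`. -/
def IsLinearizedSolution (σ : ℝ) (X : Set Base) (φ V : Base → ℝ) : Prop :=
  ∀ p ∈ X, 2 * pderiv 3 0 1 V p
    + 6 * (pderiv 2 0 0 V p * pderiv 4 0 0 φ p + pderiv 2 0 0 φ p * pderiv 4 0 0 V p)
    + 12 * pderiv 3 0 0 φ p * pderiv 3 0 0 V p + pderiv 6 0 0 V p + σ * pderiv 2 2 0 V p = 0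

/-- The variation of a solution under a symmetry group solves the linearized equation. -/
theorem OneParamGroup.IsSymmetry.isLinearizedSolution {η : OneParamGroup X} (hη : η.IsSymmetry σ)
    (hX : IsOpen X) (hφ : IsSolution σ X φ) :
    IsLinearizedSolution σ X φ (η.variation φ) := by
  intro p hp
  have h := fun a b c => η.hasDerivAt_pderiv_act hX hφ.1 hp a b c
  have h0 : ∀ a b c, pderiv a b c (η.act 0 φ) p = pderiv a b c φ p := fun a b c =>
    eqOn_pderiv hX (fun q hq => η.act_zero φ hq) a b c hp
  have hd := ((((((h 3 0 1).const_mul 2).add (((h 2 0 0).const_mul 6).mul (h 4 0 0))).add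
    (((h 3 0 0).pow 2).const_mul 6)).add (h 6 0 0)).add ((h 2 2 0).const_mul σ))
  -- The KP expression of the transformed section vanishes for every `s`, so the derivative computed
  -- in `hd` is that of the zero function.
  have hz : HasDerivAt (fun _ : ℝ => (0 : ℝ)) _ 0 :=
    hd.congr_of_eventuallyEq (Filter.Eventually.of_forall fun s =>
      ((hη φ hφ s).kp hX hp).symm)
  have e := hz.unique (hasDerivAt_const _ _)
  simp only [h0] at e
  rw [← e]
  push_cast
  ring

/-! ### The multisymplectic conservation law -/

/-- The variation of the coefficient of `dφ ∧ dy ∧ dt` in the Cartan form. -/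
def momentum (σ : ℝ) (φ V : Base → ℝ) (p : Base) : ℝ :=
  -2 * pderiv 2 0 1 V p - 6 * (pderiv 2 0 0 φ p * pderiv 3 0 0 V p
    + pderiv 3 0 0 φ p * pderiv 2 0 0 V p) - σ * pderiv 1 2 0 V p - pderiv 5 0 0 V p

/-- The variation of the coefficient of `dφ_x ∧ dy ∧ dt` in the Cartan form. -/
def momentumX (φ V : Base → ℝ) (p : Base) : ℝ :=
  pderiv 1 0 1 V p + 6 * pderiv 2 0 0 φ p * pderiv 2 0 0 V p + pderiv 4 0 0 V p

/-- The `dy ∧ dt` component of the symplectic current. -/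
def fluxX (σ : ℝ) (φ W V : Base → ℝ) (p : Base) : ℝ :=
  momentum σ φ W p * pderiv 0 0 0 V p - momentum σ φ V p * pderiv 0 0 0 W p
    + (momentumX φ W p * pderiv 1 0 0 V p - momentumX φ V p * pderiv 1 0 0 W p)
    - (pderiv 3 0 0 W p * pderiv 2 0 0 V p - pderiv 3 0 0 V p * pderiv 2 0 0 W p)

/-- The `dx ∧ dt` component of the symplectic current. -/
def fluxY (σ : ℝ) (W V : Base → ℝ) (p : Base) : ℝ :=
  -(σ * (pderiv 1 1 0 W p * pderiv 1 0 0 V p - pderiv 1 1 0 V p * pderiv 1 0 0 W p))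

/-- The `dx ∧ dy` component of the symplectic current. -/
def fluxT (W V : Base → ℝ) (p : Base) : ℝ :=
  pderiv 2 0 0 W p * pderiv 1 0 0 V p - pderiv 2 0 0 V p * pderiv 1 0 0 W p

variable {V W : Base → ℝ}

theorem contDiffOn_momentum (hX : IsOpen X) (hφ : ContDiffOn ℝ ∞ φ X) (hV : ContDiffOn ℝ ∞ V X) :
    ContDiffOn ℝ ∞ (momentum σ φ V) X := by
  have h := contDiffOn_pderiv hX hφ
  have k := contDiffOn_pderiv hX hV
  exact (((contDiffOn_const.mul (k 2 0 1)).sub (contDiffOn_const.mul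
    (((h 2 0 0).mul (k 3 0 0)).add ((h 3 0 0).mul (k 2 0 0))))).sub
    (contDiffOn_const.mul (k 1 2 0))).sub (k 5 0 0)

theorem contDiffOn_momentumX (hX : IsOpen X) (hφ : ContDiffOn ℝ ∞ φ X)
    (hV : ContDiffOn ℝ ∞ V X) : ContDiffOn ℝ ∞ (momentumX φ V) X := by
  have h := contDiffOn_pderiv hX hφ
  have k := contDiffOn_pderiv hX hV
  exact ((k 1 0 1).add ((contDiffOn_const.mul (h 2 0 0)).mul (k 2 0 0))).add (k 4 0 0)

theorem contDiffOn_fluxX (hX : IsOpen X) (hφ : ContDiffOn ℝ ∞ φ X) (hW : ContDiffOn ℝ ∞ W X)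
    (hV : ContDiffOn ℝ ∞ V X) : ContDiffOn ℝ ∞ (fluxX σ φ W V) X := by
  have h := contDiffOn_pderiv hX hW
  have k := contDiffOn_pderiv hX hV
  exact ((((contDiffOn_momentum hX hφ hW).mul (k 0 0 0)).sub
    ((contDiffOn_momentum hX hφ hV).mul (h 0 0 0))).add
    (((contDiffOn_momentumX hX hφ hW).mul (k 1 0 0)).sub
    ((contDiffOn_momentumX hX hφ hV).mul (h 1 0 0)))).sub
    (((h 3 0 0).mul (k 2 0 0)).sub ((k 3 0 0).mul (h 2 0 0)))

theorem contDiffOn_fluxY (hX : IsOpen X) (hW : ContDiffOn ℝ ∞ W X)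
    (hV : ContDiffOn ℝ ∞ V X) : ContDiffOn ℝ ∞ (fluxY σ W V) X := by
  have h := contDiffOn_pderiv hX hW
  have k := contDiffOn_pderiv hX hV
  exact (contDiffOn_const.mul (((h 1 1 0).mul (k 1 0 0)).sub ((k 1 1 0).mul (h 1 0 0)))).neg

theorem contDiffOn_fluxT (hX : IsOpen X) (hW : ContDiffOn ℝ ∞ W X)
    (hV : ContDiffOn ℝ ∞ V X) : ContDiffOn ℝ ∞ (fluxT W V) X := by
  have h := contDiffOn_pderiv hX hW
  have k := contDiffOn_pderiv hX hV
  exact ((h 2 0 0).mul (k 1 0 0)).sub ((k 2 0 0).mul (h 1 0 0))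

/-- Restricting to a coordinate line lets the one-variable sum and product rules compute the
derivatives of the fluxes. -/
theorem pd_eq_of_hasLineDerivAt {f : Base → ℝ} {i : Fin 3} {p : Base} {d : ℝ}
    (hf : DifferentiableAt ℝ f p) (h : HasLineDerivAt ℝ f d p (Pi.single i 1)) : pd i f p = d := by
  rw [← h.lineDeriv, hf.lineDeriv_eq_fderiv]
  rfl

theorem hasLineDerivAt_pderiv (hX : IsOpen X) (hV : ContDiffOn ℝ ∞ V X) {p : Base} (hp : p ∈ X)
    (i : Fin 3) (a b c : ℕ) :
    HasDerivAt (fun t : ℝ => pderiv a b c V (p + t • Pi.single i 1))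
      (pd i (pderiv a b c V) p) 0 := by
  have hd : DifferentiableAt ℝ (pderiv a b c V) p :=
    ((contDiffOn_pderiv hX hV a b c).contDiffAt (hX.mem_nhds hp)).differentiableAt (by simp)
  exact hd.hasFDerivAt.hasLineDerivAt _

/-- The symplectic current of two solutions of the linearized equation is conserved. -/
theorem div_flux_eq_zero (hX : IsOpen X) (hφ : ContDiffOn ℝ ∞ φ X) (hW : ContDiffOn ℝ ∞ W X)
    (hV : ContDiffOn ℝ ∞ V X) (lW : IsLinearizedSolution σ X φ W)
    (lV : IsLinearizedSolution σ X φ V) {p : Base} (hp : p ∈ X) :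
    pd 0 (fluxX σ φ W V) p - pd 1 (fluxY σ W V) p + pd 2 (fluxT W V) p = 0 := by
  have dX : DifferentiableAt ℝ (fluxX σ φ W V) p :=
    ((contDiffOn_fluxX hX hφ hW hV).contDiffAt (hX.mem_nhds hp)).differentiableAt (by simp)
  have dY : DifferentiableAt ℝ (fluxY σ W V) p :=
    ((contDiffOn_fluxY hX hW hV).contDiffAt (hX.mem_nhds hp)).differentiableAt (by simp)
  have dT : DifferentiableAt ℝ (fluxT W V) p :=
    ((contDiffOn_fluxT hX hW hV).contDiffAt (hX.mem_nhds hp)).differentiableAt (by simp)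
  have f := fun i a b c => hasLineDerivAt_pderiv hX hφ hp i a b c
  have w := fun i a b c => hasLineDerivAt_pderiv hX hW hp i a b c
  have v := fun i a b c => hasLineDerivAt_pderiv hX hV hp i a b c
  have mW := (((((w 0 2 0 1).const_mul (-2)).sub ((((f 0 2 0 0).mul (w 0 3 0 0)).add
    ((f 0 3 0 0).mul (w 0 2 0 0))).const_mul 6)).sub ((w 0 1 2 0).const_mul σ)).sub (w 0 5 0 0))
  have mV := (((((v 0 2 0 1).const_mul (-2)).sub ((((f 0 2 0 0).mul (v 0 3 0 0)).add
    ((f 0 3 0 0).mul (v 0 2 0 0))).const_mul 6)).sub ((v 0 1 2 0).const_mul σ)).sub (v 0 5 0 0))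
  have nW := ((w 0 1 0 1).add (((f 0 2 0 0).const_mul 6).mul (w 0 2 0 0))).add (w 0 4 0 0)
  have nV := ((v 0 1 0 1).add (((f 0 2 0 0).const_mul 6).mul (v 0 2 0 0))).add (v 0 4 0 0)
  have eX := pd_eq_of_hasLineDerivAt dX
    ((((mW.mul (v 0 0 0 0)).sub (mV.mul (w 0 0 0 0))).add
      ((nW.mul (v 0 1 0 0)).sub (nV.mul (w 0 1 0 0)))).sub
      (((w 0 3 0 0).mul (v 0 2 0 0)).sub ((v 0 3 0 0).mul (w 0 2 0 0))))
  have eY := pd_eq_of_hasLineDerivAt dY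
    ((((w 1 1 1 0).mul (v 1 1 0 0)).sub ((v 1 1 1 0).mul (w 1 1 0 0))).const_mul σ).neg
  have eT := pd_eq_of_hasLineDerivAt dT
    (((w 2 2 0 0).mul (v 2 1 0 0)).sub ((v 2 2 0 0).mul (w 2 1 0 0)))
  rw [eX, eY, eT]
  simp only [pd_zero_pderiv, pd_one_pderiv hX hW _ _ _ hp, pd_one_pderiv hX hV _ _ _ hp,
    pd_two_pderiv hX hW _ _ _ hp, pd_two_pderiv hX hV _ _ _ hp, zero_smul, add_zero,
    Pi.mul_apply, Pi.add_apply, Pi.sub_apply, Nat.reduceAdd]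
  -- Green's identity: all other products of derivatives of `W` and `V` cancel, and the divergence
  -- is exactly `W ℓ(V) - V ℓ(W)`.
  linear_combination pderiv 0 0 0 W p * lV p hp - pderiv 0 0 0 V p * lW p hp

/-- On a solution, the contraction of the multisymplectic form with two prolonged symmetries is
the symplectic current of the variations. -/
theorem pullback_contract_apply (hX : IsOpen X) (hφ : IsSolution σ X φ) (η ξ : OneParamGroup X)
    {p : Base} (hp : p ∈ X) (m : Fin 2 → Base) :
    pullback (jet φ) (contract η.jetGenerator (contract ξ.jetGenerator (Omega σ))) p m =
      -(fluxX σ φ (ξ.variation φ) (η.variation φ) p * (m 0 1 * m 1 2 - m 0 2 * m 1 1)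
        + fluxY σ (ξ.variation φ) (η.variation φ) p * (m 0 0 * m 1 2 - m 0 2 * m 1 0)
        + fluxT (ξ.variation φ) (η.variation φ) p * (m 0 0 * m 1 1 - m 0 1 * m 1 0)) := by
  set T := fderiv ℝ (jet φ) p with hT
  set Ω := Omega σ (jet φ p) with hΩ
  set w : J5 := (0, fun J => pdJ J (ξ.variation φ) p) with hw
  set v : J5 := (0, fun J => pdJ J (η.variation φ) p) with hv
  have hexp : pullback (jet φ) (contract η.jetGenerator (contract ξ.jetGenerator (Omega σ))) p m =
      Ω ![ξ.jetGenerator (jet φ p), η.jetGenerator (jet φ p), T (m 0), T (m 1)] := by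
    simp only [pullback, contract, ContinuousAlternatingMap.compContinuousLinearMap_apply,
      ContinuousAlternatingMap.curryLeft_apply_apply]
    congr 1
    funext k
    fin_cases k <;> rfl
  have hzero := fun u a b c => hφ.Omega_eq_zero hp u a b c
  have hadd0 : ∀ a a' b c d : J5, Ω ![a + a', b, c, d] = Ω ![a, b, c, d] + Ω ![a', b, c, d] :=
    fun a a' b c d => by
      have hu : ∀ x : J5, Function.update ![0, b, c, d] 0 x = ![x, b, c, d] := fun x => by
        funext k; fin_cases k <;> rfl
      have := Ω.map_update_add ![0, b, c, d] 0 a a'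
      rwa [hu, hu, hu] at this
  have hadd1 : ∀ a b b' c d : J5, Ω ![a, b + b', c, d] = Ω ![a, b, c, d] + Ω ![a, b', c, d] :=
    fun a b b' c d => by
      have hu : ∀ x : J5, Function.update ![a, 0, c, d] 1 x = ![a, x, c, d] := fun x => by
        funext k; fin_cases k <;> rfl
      have := Ω.map_update_add ![a, 0, c, d] 1 b b'
      rwa [hu, hu, hu] at this
  have hswap : ∀ a b c d : J5, Ω ![a, b, c, d] = -Ω ![b, a, c, d] := fun a b c d => by
    have := Ω.map_swap ![b, a, c, d] (i := 0) (j := 1) (by decide)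
    refine Eq.trans (congrArg Ω ?_) this
    funext k
    fin_cases k <;> rfl
  -- Each generator is a tangent vector plus a vertical one. Of the four terms, those with at least
  -- one tangent part have three tangent arguments and vanish by `hzero`, after a swap in one case,
  -- which leaves the pair `w`, `v`.
  rw [hexp, ξ.jetGenerator_jet hX hφ.1 hp, η.jetGenerator_jet hX hφ.1 hp, hadd1, hadd0, hadd0,
    hzero, hzero, hswap (T _) v, hzero, Omega_vertical σ (jet φ p) w v _ _ rfl rfl, hT,
    fderiv_jet hX hφ.1 hp, fderiv_jet hX hφ.1 hp]
  simp only [zero_add, neg_zero, fluxX, fluxY, fluxT]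
  have hmW : dCoeffPhi σ (jet φ p) w = momentum σ φ (ξ.variation φ) p := rfl
  have hmV : dCoeffPhi σ (jet φ p) v = momentum σ φ (η.variation φ) p := rfl
  have hnW : dCoeffPhiX (jet φ p) w = momentumX φ (ξ.variation φ) p := rfl
  have hnV : dCoeffPhiX (jet φ p) v = momentumX φ (η.variation φ) p := rfl
  rw [hmW, hmV, hnW, hnV]
  have e : ∀ (a b c : Fin 6) (h : (a : ℕ) + b + c ≤ 5) (Q : Base → ℝ),
      pdJ (mi a b c h) Q p = pderiv a b c Q p := fun _ _ _ _ _ => rfl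
  simp only [hw, hv, e, Fin.isValue, Fin.val_zero, Fin.val_one, Fin.val_two]
  rw [show ((3 : Fin 6) : ℕ) = 3 from rfl]
  ring

/-- The symplectic current is a smooth `2`-form. -/
theorem contDiffOn_pullback_contract (hX : IsOpen X) (hφ : IsSolution σ X φ)
    (η ξ : OneParamGroup X) :
    ContDiffOn ℝ 1
      (pullback (jet φ) (contract η.jetGenerator (contract ξ.jetGenerator (Omega σ)))) X := by
  intro p hp
  refine (contDiffAt_form fun i _ => ?_).contDiffWithinAt
  have hη := η.contDiffOn_variation hX hφ.1
  have hξ := ξ.contDiffOn_variation hX hφ.1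
  have hflux := ((((contDiffOn_fluxX (σ := σ) hX hφ.1 hξ hη).mul contDiffOn_const).add
    ((contDiffOn_fluxY (σ := σ) hX hξ hη).mul contDiffOn_const)).add
    ((contDiffOn_fluxT hX hξ hη).mul contDiffOn_const)).neg.congr
    fun q hq => pullback_contract_apply hX hφ η ξ hq fun k => frame (i k)
  exact (hflux.contDiffAt (hX.mem_nhds hp)).of_le (by norm_cast)

/-- The symplectic current of two symmetries is closed on solutions. -/
theorem extDeriv_pullback_contract_eq_zero (hX : IsOpen X) (hφ : IsSolution σ X φ)
    {η ξ : OneParamGroup X} (hη : η.IsSymmetry σ) (hξ : ξ.IsSymmetry σ) {p : Base} (hp : p ∈ X) :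
    extDeriv (pullback (jet φ) (contract η.jetGenerator (contract ξ.jetGenerator (Omega σ)))) p
      frame = 0 := by
  have hd : DifferentiableAt ℝ
      (pullback (jet φ) (contract η.jetGenerator (contract ξ.jetGenerator (Omega σ)))) p :=
    ((contDiffOn_pullback_contract hX hφ η ξ).contDiffAt (hX.mem_nhds hp)).differentiableAt
      one_ne_zero
  have hcomp : ∀ (j : Fin 3) (g : Base → ℝ),
      (∀ q ∈ X, pullback (jet φ) (contract η.jetGenerator (contract ξ.jetGenerator (Omega σ))) q
        (j.removeNth frame) = -g q) →
      fderiv ℝ (fun q => pullback (jet φ)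
        (contract η.jetGenerator (contract ξ.jetGenerator (Omega σ))) q (j.removeNth frame)) p
        (frame j) = -pd j g p := by
    intro j g hg
    have := eqOn_dirDeriv hX (fun q hq => hg q hq) (frame j) hp
    refine Eq.trans this ?_
    change fderiv ℝ (fun q => -g q) p (frame j) = _
    rw [fderiv_fun_neg]
    rfl
  -- Omitting the frame vector `j` selects one flux component, and the alternating signs of `d`
  -- reproduce the divergence in `div_flux_eq_zero`.
  have h0 := hcomp 0 (fluxX σ φ (ξ.variation φ) (η.variation φ)) fun q hq => by
    rw [pullback_contract_apply hX hφ η ξ hq]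
    simp [Fin.removeNth, frame, Fin.succAbove]
  have h1 := hcomp 1 (fluxY σ (ξ.variation φ) (η.variation φ)) fun q hq => by
    rw [pullback_contract_apply hX hφ η ξ hq]
    simp [Fin.removeNth, frame, Fin.succAbove]
  have h2 := hcomp 2 (fluxT (ξ.variation φ) (η.variation φ)) fun q hq => by
    rw [pullback_contract_apply hX hφ η ξ hq]
    simp [Fin.removeNth, frame, Fin.succAbove]
  rw [extDeriv_apply hd, Fin.sum_univ_three, h0, h1, h2]
  have := div_flux_eq_zero hX hφ.1 (ξ.contDiffOn_variation hX hφ.1)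
    (η.contDiffOn_variation hX hφ.1) (hξ.isLinearizedSolution hX hφ)
    (hη.isLinearizedSolution hX hφ) hp
  simp
  linarith

end Conservation

end KP

end

theorem theorem2p3 (σ : ℝ) (X : Set KP.Base) (hX : IsOpen X)
    (η ξ : KP.OneParamGroup X) (hη : η.IsSymmetry σ) (hξ : ξ.IsSymmetry σ)
    (φ : KP.Base → ℝ) (hφ : KP.IsSolution σ X φ)
    (U : Set KP.Base) (hU : IsOpen U) (hUX : closure U ⊆ X) (A : KP.CornerAtlas U) :
    A.boundaryIntegral
      (KP.pullback (KP.jet φ)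
        (KP.contract η.jetGenerator (KP.contract ξ.jetGenerator (KP.Omega σ)))) = 0 := by
  rw [A.boundaryIntegral_eq hU hX hUX (KP.contDiffOn_pullback_contract hX hφ η ξ)]
  exact setIntegral_eq_zero_of_forall_eq_zero fun p hp =>
    KP.extDeriv_pullback_contract_eq_zero hX hφ hη hξ (hUX (subset_closure hp))
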